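/- **Setting.** Let $\mathcal C$ be a strict $(2,1)$-category (a strict 2-category all of whose 2-cells are invertible) with a chosen 2-terminal object. A *(split) display map 2-category* structure on $\mathcal C$ is a class $\mathcal D$ of 1-cells $P_A:\Gamma.A\to\Gamma$, called *display maps* (we write $A$ for $P_A$), such that: 1. for every display map $P_A:\Gamma.A\to\Gamma$ and every $f:\Delta\to\Gamma$ there are a chosen display map $P_{A[f]}:\Delta.A[f]\to\Delta$ and a 1-cell $f^\bullet:\Delta.A[f]\to\Gamma.A$ forming a square over $f$ which is a pullback for 1-cells and for 2-cells; moreover $A[1_\Gamma]=A$, $1_\Gamma^\bullet=1_{\Gamma.A}$, $A[fg]=A[f][g]$, $(fg)^\bullet=f^\bullet g^\bullet$. Iterating, one writes $f^{\bullet\bullet}$, $f^{\bullet\bullet\bullet}$ for the 1-cells over $f^\bullet$, $f^{\bullet\bullet}$. Write $A^\blacktriangledown=A[P_A]$. By the pullback property 1-cells and 2-cells over $\Gamma$ with codomain a display map over $\Gamma$ (in particular sections and vertical 2-cells between them) are re-indexed along $f$, which is denoted $(-)[f]$; for $u:f\to P_A$ over $\Gamma$, $1;u$ is the section of $P_{A[f]}$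 with $f^\bullet(1;u)=u$ (similarly for 2-cells), so that $a[f]=1;(af)$; 2. every display map is a cloven isofibration: for every 2-cell $p:f\Rightarrow P_Ag$ there are a chosen 1-cell $\mathsf t_g^p$ and a chosen 2-cell $\tau_g^p:\mathsf t_g^p\Rightarrow g$ with $P_A\mathsf t_g^p=f$ and $P_A*\tau_g^p=p$, and $\mathsf t_{gh}^{p*h}=\mathsf t_g^ph$, $\tau_{gh}^{p*h}=\tau_g^p*h$ for all composable 1-cells $h$; 3. these choices are compatible with re-indexing: let $\Gamma.A_1.\cdots.A_n\to\cdots\to\Gamma.A_1\to\Gamma$ ($n\ge1$) be display maps, with composite $P_{\mathbf A}:\Gamma.\mathbf A\to\Gamma$, let $P_C$ be a display map with codomain $\Gamma.\mathbf A$, let $f:\Delta\to\Gamma$, and let $f.\mathbf A:\Delta.\mathbf A[f]\to\Gamma.\mathbf A$ be the iterated $f^{\bullet\cdots\bullet}$. If $f':\Omega'\to\Omega$, $g:\Omega\to\Gamma.\mathbf A.C$, $h:\Omega\to\Gamma.\mathbf A$, $g':\Omega'\to\Delta.\mathbf A[f].C[f.\mathbf A]$, $h':\Omega'\to\Delta.\mathbf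 A[f]$ satisfy $(f.\mathbf A)^\bullet g'=gf'$ and $(f.\mathbf A)h'=hf'$, and if $p:h\Rightarrow P_Cg$ and $p':h'\Rightarrow P_{C[f.\mathbf A]}g'$ are 2-cells with $P_{\mathbf A}*p=1$, $P_{\mathbf A[f]}*p'=1$, $(f.\mathbf A)*p'=p*f'$, then $(f.\mathbf A)^\bullet\,\mathsf t_{g'}^{p'}=\mathsf t_g^pf'$ and $(f.\mathbf A)^\bullet*\tau_{g'}^{p'}=\tau_g^p*f'$. *Axiomatic $=$-types*: for every display map $P_A:\Gamma.A\to\Gamma$, a chosen display map $P_{\mathsf{Id}_A}:\Gamma.A.A^\blacktriangledown.\mathsf{Id}_A\to\Gamma.A.A^\blacktriangledown$ and a 2-cell $\alpha_A:\mathsf s\Rightarrow\mathsf t$ of $\mathcal C/\Gamma$, where $\mathsf s=P_{A^\blacktriangledown}P_{\mathsf{Id}_A}$ and $\mathsf t=P_A^\bullet P_{\mathsf{Id}_A}$, such that $\alpha_A$ is an arrow object of $P_A$ in $\mathcal C/\Gamma$ (for every $h:\Theta\to\Gamma$, composition with $\alpha_A$ is an isomorphism of categories from $(\mathcal C/\Gamma)(h,P_AP_{A^\blacktriangledown}P_{\mathsf{Id}_A})$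 to the arrow category of $(\mathcal C/\Gamma)(h,P_A)$), and $\mathsf{Id}_A[f^{\bullet\bullet}]=\mathsf{Id}_{A[f]}$, $\alpha_A[f]=\alpha_{A[f]}$ for every $f:\Delta\to\Gamma$. *Axiomatic $\Pi$-types and axiomatic function extensionality*: for every display maps $P_A:\Gamma.A\to\Gamma$ and $P_B:\Gamma.A.B\to\Gamma.A$, a chosen display map $\Gamma.\Pi_A^B\to\Gamma$ with $\Pi_A^B[f]=\Pi_{A[f]}^{B[f^\bullet]}$ for all $f:\Delta\to\Gamma$, and, for all $f:\Delta\to\Gamma$, functors $\lambda_A^B:(\mathcal C/\Gamma.A)(f^\bullet,P_B)\rightleftarrows(\mathcal C/\Gamma)(f,P_{\Pi_A^B}):\mathsf{app}_A^B$ with natural isomorphisms $\beta^{A,B}:\mathsf{app}_A^B\lambda_A^B\Rightarrow1$ and $\eta^{A,B}:1\Rightarrow\lambda_A^B\mathsf{app}_A^B$, such that $\lambda$ and $\mathsf{app}$ commute (as functors) with precomposition by $g^\bullet$ and $g$, for every $g:\Delta'\to\Delta$, and with the functors $1;(-)$ from data over $f$ to data over $1_\Delta$ for $A[f]$ and $B[f^\bullet]$,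 and $\beta_h^{A,B}g^\bullet=\beta^{A,B}_{hg^\bullet}$, $\eta_k^{A,B}g=\eta^{A,B}_{kg}$, $1;\beta_h^{A,B}=\beta^{A[f],B[f^\bullet]}_{1;h}$, $1;\eta_k^{A,B}=\eta_{1;k}^{A[f],B[f^\bullet]}$. **Derived notions.** For sections $a,b$ of $P_A$, $a;b:\Gamma\to\Gamma.A.A^\blacktriangledown$ is the 1-cell with $P_{A^\blacktriangledown}(a;b)=a$, $P_A^\bullet(a;b)=b$. For a vertical 2-cell $\sigma:a\Rightarrow b$, $\{\sigma\}$ is the section of $P_{\mathsf{Id}_A[a;b]}$ induced by the unique 1-cell $x$ over $\Gamma$ with $\alpha_A*x=\sigma$. The 1-cell $\mathsf r_A:\Gamma.A\to\Gamma.A.A^\blacktriangledown.\mathsf{Id}_A$ is the unique one over $\Gamma$ with $\alpha_A*\mathsf r_A=1_{1_{\Gamma.A}}$, and $\varphi_A:1\Rightarrow\mathsf r_A\mathsf t$ is the unique 2-cell over $\Gamma$ with $\mathsf s*\varphi_A=\alpha_A$ and $\mathsf t*\varphi_A=1_{\mathsf t}$. For a display map $P_C$ with codomain $\Gamma.A.A^\blacktriangledown.\mathsf{Id}_A$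 and a section $c$ of $P_{C[\mathsf r_A]}$, $\mathsf J_c=\mathsf t_{\mathsf r_A^\bullet c\mathsf t}^{\varphi_A}$, a section of $P_C$. For $P_A$ over $\Gamma$ and $P_B$ over $\Gamma.A$, $\mathsf{ev}=1;\mathsf{app}_A^B(1_{\Gamma.\Pi_A^B})$, a section of $P_{B[P_{\Pi_A^B}^\bullet]}$. From now on $\mathsf s,\mathsf t$ are those of $\mathsf{Id}_{\Pi_A^B}$. Let $P_{T_A^B}$ be the display map $$\Gamma.\Pi_A^B.(\Pi_A^B)^\blacktriangledown.\mathsf{Id}_{\Pi_A^B}.\Bigl(\Pi_{A[P_{\Pi_A^B}\mathsf s]}^{\mathsf{Id}_{B[(P_{\Pi_A^B}\mathsf s)^\bullet]}[\mathsf{ev}[\mathsf s^\bullet];\mathsf{ev}[\mathsf t^\bullet]]}\Bigr)\longrightarrow\Gamma.\Pi_A^B.(\Pi_A^B)^\blacktriangledown.\mathsf{Id}_{\Pi_A^B}.$$ One has $T_A^B[\mathsf r_{\Pi_A^B}]=\Pi_{A[P_{\Pi_A^B}]}^{\mathsf{Id}_{B[P_{\Pi_A^B}^\bullet]}[\mathsf{ev};\mathsf{ev}]}$,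 and $\mathsf{happly}_A^B=\mathsf J_c$ with $c=\lambda(\mathsf r_{B[P_{\Pi_A^B}^\bullet]}[\mathsf{ev}])$, where $\mathsf r_{B[P_{\Pi_A^B}^\bullet]}[\mathsf{ev}]$ is the section of $P_{\mathsf{Id}_{B[P_{\Pi_A^B}^\bullet]}[\mathsf{ev};\mathsf{ev}]}$ which $(\mathsf{ev};\mathsf{ev})^\bullet$ takes to $\mathsf r_{B[P_{\Pi_A^B}^\bullet]}\,\mathsf{ev}$. Let $\tilde\alpha:\tilde{\mathsf s}\Rightarrow\tilde{\mathsf t}$ be $1;\alpha_{\Pi_A^B}$, a 2-cell between sections of $P_{\Pi_A^B[P_{\Pi_A^B}\mathsf s]}$ (note that $\alpha_{\Pi_A^B}$ is a 2-cell over $\Gamma$ with domain $P_{\Pi_A^B}\mathsf s$). One has $\mathsf{app}\,\tilde{\mathsf s}=\mathsf{ev}[\mathsf s^\bullet]$ and $\mathsf{app}\,\tilde{\mathsf t}=\mathsf{ev}[\mathsf t^\bullet]$; let $\mathsf{happ}_A^B=\{\mathsf{app}\,\tilde\alpha\}$, so that $\lambda\,\mathsf{happ}_A^B$ is, like $\mathsf{happly}_A^B$,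 a section of $P_{T_A^B}$. **Theorem (the happy theorem).** Let $(\mathcal C,\mathcal D)$ be a display map 2-category endowed with axiomatic $=$-types and with axiomatic $\Pi$-types and axiomatic function extensionality. Then there is a family of arrows $$\theta_A^B:\mathsf{happly}_A^B\Longrightarrow\lambda\,\mathsf{happ}_A^B$$ in the category of sections of $P_{T_A^B}$, one for every object $\Gamma$ and all display maps $P_A:\Gamma.A\to\Gamma$ and $P_B:\Gamma.A.B\to\Gamma.A$, which is stable under re-indexing: for every $f:\Delta\to\Gamma$ one has $T_A^B[f^{\bullet\bullet\bullet}]=T_{A[f]}^{B[f^\bullet]}$ and $$\theta_A^B[f^{\bullet\bullet\bullet}]=\theta_{A[f]}^{B[f^\bullet]}$$ as 2-cells between sections of $P_{T_{A[f]}^{B[f^\bullet]}}$ (in particular their sources agree, and their targets agree), where $f^{\bullet\bullet\bullet}:\Delta.\Pi'.\Pi'^\blacktriangledown.\mathsf{Id}_{\Pi'}\to\Gamma.\Pi_A^B.(\Pi_A^B)^\blacktriangledown.\mathsf{Id}_{\Pi_A^B}$ with $\Pi'=\Pi_A^B[f]=\Pi_{A[f]}^{B[f^\bullet]}$. -/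

import Mathlib

open CategoryTheory Bicategory

universe w v u

namespace DisplayMap

section Slice

variable {C : Type u} [Bicategory.{w, v} C] [Bicategory.Strict C]

/-- A 1-cell `h ⟶ p` of the strict slice 2-category `C / Γ`. -/
@[ext]
structure SliceHom {X Y Γ : C} (h : X ⟶ Γ) (p : Y ⟶ Γ) where
  map : X ⟶ Y
  w : map ≫ p = h

namespace SliceHom

variable {X X' Y E Γ : C} {h : X ⟶ Γ} {p : Y ⟶ Γ}

/-- A 2-cell of the strict slice 2-category `C / Γ`: a 2-cell of `C` lying over an identity. -/
@[ext]
structure Hom (a b : SliceHom h p) where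
  cell : a.map ⟶ b.map
  vertical : cell ▷ p = eqToHom (a.w.trans b.w.symm)

/-- The hom-category `(C / Γ)(h, p)`. -/
instance : Category (SliceHom h p) where
  Hom := Hom
  id a := ⟨𝟙 a.map, by simp⟩
  comp σ τ := ⟨σ.cell ≫ τ.cell, by simp [σ.vertical, τ.vertical]⟩

@[ext]
theorem hom_ext {a b : SliceHom h p} (σ τ : a ⟶ b) (e : σ.cell = τ.cell) : σ = τ :=
  Hom.ext e

@[simp] theorem id_cell (a : SliceHom h p) : Hom.cell (𝟙 a) = 𝟙 a.map := rfl
@[simp] theorem comp_cell {a b c : SliceHom h p} (σ : a ⟶ b) (τ : b ⟶ c) :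
    (σ ≫ τ).cell = σ.cell ≫ τ.cell := rfl

@[simp] theorem eqToHom_cell {a b : SliceHom h p} (e : a = b) :
    Hom.cell (eqToHom e) = eqToHom (congrArg SliceHom.map e) := by
  subst e; rfl

/-- Precomposition by a 1-cell `g : h' ⟶ h` of `C / Γ`. -/
def precomp (g : X' ⟶ X) {h' : X' ⟶ Γ} (e : g ≫ h = h') :
    SliceHom h p ⥤ SliceHom h' p where
  obj a := ⟨g ≫ a.map, by rw [Category.assoc, a.w, e]⟩
  map {a b} σ := ⟨g ◁ σ.cell, by
    have := σ.vertical
    simp [whisker_assoc, this, Strict.associator_eqToIso]⟩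
  map_id a := by ext; simp
  map_comp σ τ := by ext; simp

theorem vertical_whiskerRight {e : E ⟶ Γ} {a b : SliceHom h e} (γ : a ⟶ b)
    (s : SliceHom e p) :
    (γ.cell ▷ s.map) ▷ p = eqToHom (by rw [Category.assoc, Category.assoc, s.w, a.w, b.w]) := by
  obtain ⟨s, rfl⟩ := s
  have h1 := γ.vertical
  rw [← cancel_epi (α_ a.map s p).inv, ← cancel_mono (α_ b.map s p).hom]
  rw [Category.assoc, ← whiskerRight_comp, h1]
  simp [Strict.associator_eqToIso]

/-- Post-composition with a 2-cell `α : s ⟶ t` of `C / Γ` -/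
def arrowComparison {e : E ⟶ Γ} {s t : SliceHom e p} (α : s ⟶ t) (h : X ⟶ Γ) :
    SliceHom h e ⥤ Arrow (SliceHom h p) where
  obj a := Arrow.mk ((precomp a.map a.w).map α)
  map {a b} γ := Arrow.homMk
    (⟨γ.cell ▷ s.map, vertical_whiskerRight γ s⟩ :
      (precomp a.map a.w).obj s ⟶ (precomp b.map b.w).obj s)
    (⟨γ.cell ▷ t.map, vertical_whiskerRight γ t⟩ :
      (precomp a.map a.w).obj t ⟶ (precomp b.map b.w).obj t)
    (by ext; exact (whisker_exchange γ.cell α.cell).symm)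
  map_id a := by ext <;> simp [precomp]
  map_comp σ τ := by ext <;> simp [precomp]

/-- `α : s ⟶ t` is an arrow object of `p` (in `C / Γ`): the comparison functors
`(C / Γ)(h, e) ⥤ (C / Γ)(h, p)^→` are isomorphisms of categories, for all `h`. -/
def IsArrowObject {e : E ⟶ Γ} {s t : SliceHom e p} (α : s ⟶ t) : Prop :=
  ∀ {X : C} (h : X ⟶ Γ), Function.Bijective (arrowComparison α h).obj ∧
    (arrowComparison α h).Full ∧ (arrowComparison α h).Faithful

end SliceHom

/-- The display maps of codomain `Γ`: the 1-cells of the class `D` with target `Γ`. -/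
@[ext]
structure Disp (D : MorphismProperty C) (Γ : C) where
  obj : C
  p : obj ⟶ Γ
  mem : D p

/-- A class of 1-cells with a chosen 2-terminal object and a split choice of
1- and 2-dimensional pullbacks. -/
structure SplitDisplay (C : Type u) [Bicategory.{w, v} C] [Bicategory.Strict C] where
  pt : C
  pt_unique : ∀ X : C, Nonempty (Unique (X ⟶ pt))
  pt_unique₂ : ∀ {X : C} (f g : X ⟶ pt), Nonempty (Unique (f ⟶ g))
  D : MorphismProperty C
  /-- `A[f]` -/
  re : ∀ {Γ Ξ : C}, Disp D Γ → (Ξ ⟶ Γ) → Disp D Ξ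
  /-- `f.A`, also written `f•` -/
  up : ∀ {Γ Ξ : C} (f : Ξ ⟶ Γ) (A : Disp D Γ), (re A f).obj ⟶ A.obj
  isPullback : ∀ {Γ Ξ : C} (f : Ξ ⟶ Γ) (A : Disp D Γ), IsPullback (up f A) (re A f).p A.p f
  isPullback₂ : ∀ {Γ Ξ : C} (f : Ξ ⟶ Γ) (A : Disp D Γ) {Ω : C} {x y : Ω ⟶ (re A f).obj}
    (a : x ≫ up f A ⟶ y ≫ up f A) (b : x ≫ (re A f).p ⟶ y ≫ (re A f).p),
    Arrow.mk (a ▷ A.p) = Arrow.mk (b ▷ f) →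
    ∃! c : x ⟶ y, c ▷ up f A = a ∧ c ▷ (re A f).p = b
  re_id : ∀ {Γ : C} (A : Disp D Γ), re A (𝟙 Γ) = A
  up_id : ∀ {Γ : C} (A : Disp D Γ), up (𝟙 Γ) A = eqToHom (congrArg Disp.obj (re_id A))
  re_comp : ∀ {Γ Ξ Θ : C} (g : Θ ⟶ Ξ) (f : Ξ ⟶ Γ) (A : Disp D Γ), re A (g ≫ f) = re (re A f) g
  up_comp : ∀ {Γ Ξ Θ : C} (g : Θ ⟶ Ξ) (f : Ξ ⟶ Γ) (A : Disp D Γ),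
    up (g ≫ f) A = eqToHom (congrArg Disp.obj (re_comp g f A)) ≫ up g (re A f) ≫ up f A

namespace SplitDisplay

/-- Telescopes `A₁, …, Aₙ` (with `n ≥ 0`) of display maps
`Γ.A₁ ⟶ Γ`, `Γ.A₁.A₂ ⟶ Γ.A₁`, …, of base `Γ`. -/
inductive Tele (S : SplitDisplay C) : C → Type (max u v) where
  | nil (Γ : C) : Tele S Γ
  | cons {Γ : C} (A : Disp S.D Γ) (T : Tele S A.obj) : Tele S Γ

namespace Tele

variable {S : SplitDisplay C}

/-- The object `Γ.A₁.….Aₙ`. -/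
def obj : {Γ : C} → Tele S Γ → C
  | _, nil Γ => Γ
  | _, cons _ T => T.obj

/-- The composite of display maps `Γ.A₁.….Aₙ ⟶ Γ`. -/
def p : {Γ : C} → (T : Tele S Γ) → (T.obj ⟶ Γ)
  | _, nil Γ => 𝟙 Γ
  | _, cons A T => T.p ≫ A.p

/-- The telescope `A₁[f], A₂[f•], A₃[f••], …`. -/
def re : {Γ Ξ : C} → Tele S Γ → (Ξ ⟶ Γ) → Tele S Ξ
  | _, Ξ, nil _, _ => nil Ξ
  | _, _, cons A T, f => cons (S.re A f) (T.re (S.up f A))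

/-- The 1-cell `f•⋯• : Ξ.A₁[f].⋯ ⟶ Γ.A₁.⋯`. -/
def up : {Γ Ξ : C} → (T : Tele S Γ) → (f : Ξ ⟶ Γ) → ((T.re f).obj ⟶ T.obj)
  | _, _, nil _, f => f
  | _, _, cons A T, f => T.up (S.up f A)

end Tele

end SplitDisplay

/-- A split display map 2-category: split choices of pullbacks of display maps, which are moreover
cloven isofibrations, compatibly with re-indexing. -/
structure DisplayMap2Category (C : Type u) [Bicategory.{w, v} C] [Bicategory.Strict C]
    [IsLocallyGroupoid C] extends SplitDisplay C where
  /-- The chosen 1-cell lifting `p`. -/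
  t : ∀ {Γ Ξ : C} (A : Disp D Γ) {f : Ξ ⟶ Γ} (g : Ξ ⟶ A.obj), (f ⟶ g ≫ A.p) → (Ξ ⟶ A.obj)
  /-- The chosen 2-cell lifting `p`. -/
  τ : ∀ {Γ Ξ : C} (A : Disp D Γ) {f : Ξ ⟶ Γ} (g : Ξ ⟶ A.obj) (p : f ⟶ g ≫ A.p), t A g p ⟶ g
  t_p : ∀ {Γ Ξ : C} (A : Disp D Γ) {f : Ξ ⟶ Γ} (g : Ξ ⟶ A.obj) (p : f ⟶ g ≫ A.p),
    t A g p ≫ A.p = f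
  τ_p : ∀ {Γ Ξ : C} (A : Disp D Γ) {f : Ξ ⟶ Γ} (g : Ξ ⟶ A.obj) (p : f ⟶ g ≫ A.p),
    τ A g p ▷ A.p = eqToHom (t_p A g p) ≫ p
  t_comp : ∀ {Γ Ξ Ω : C} (A : Disp D Γ) {f : Ξ ⟶ Γ} (g : Ξ ⟶ A.obj) (p : f ⟶ g ≫ A.p)
    (h : Ω ⟶ Ξ), t A (h ≫ g) (h ◁ p ≫ (α_ h g A.p).inv) = h ≫ t A g p
  τ_comp : ∀ {Γ Ξ Ω : C} (A : Disp D Γ) {f : Ξ ⟶ Γ} (g : Ξ ⟶ A.obj) (p : f ⟶ g ≫ A.p)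
    (h : Ω ⟶ Ξ), Arrow.mk (τ A (h ≫ g) (h ◁ p ≫ (α_ h g A.p).inv)) = Arrow.mk (h ◁ τ A g p)
  /-- Compatibility of the chosen lifts with re-indexing along `f`, for a display map `P_Q` over a
  nonempty telescope `T` of base `Γ`. The 2-cell `p'` is the re-indexing `p[f]` of `p`. -/
  cleavage_stable : ∀ {Γ Ξ : C} (f : Ξ ⟶ Γ) (T : SplitDisplay.Tele toSplitDisplay Γ)
    (Q : Disp D T.obj) {Ω Ω' : C} (f' : Ω' ⟶ Ω)
    (g : Ω ⟶ Q.obj) (h : Ω ⟶ T.obj) (g' : Ω' ⟶ (re Q (T.up f)).obj) (h' : Ω' ⟶ (T.re f).obj)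
    (p : h ⟶ g ≫ Q.p) (p' : h' ⟶ g' ≫ (re Q (T.up f)).p),
    T ≠ SplitDisplay.Tele.nil Γ →
    g' ≫ up (T.up f) Q = f' ≫ g →
    h' ≫ T.up f = f' ≫ h →
    Arrow.mk (p ▷ T.p) = Arrow.mk (𝟙 (h ≫ T.p)) →
    Arrow.mk (p' ▷ (T.re f).p) = Arrow.mk (𝟙 (h' ≫ (T.re f).p)) →
    Arrow.mk (p' ▷ T.up f) = Arrow.mk (f' ◁ p) →
    t (re Q (T.up f)) g' p' ≫ up (T.up f) Q = f' ≫ t Q g p ∧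
    Arrow.mk (τ (re Q (T.up f)) g' p' ▷ up (T.up f) Q) = Arrow.mk (f' ◁ τ Q g p)

namespace SplitDisplay

variable (S : SplitDisplay C)

/-- `A▼ = A[P_A]`. -/
abbrev wk {Γ : C} (A : Disp S.D Γ) : Disp S.D A.obj := S.re A A.p

/-- Sections of `P_A`, with the vertical 2-cells between them: the category `(C / Γ)(1, P_A)`. -/
abbrev Sec {Γ : C} (A : Disp S.D Γ) := SliceHom (𝟙 Γ) A.p

variable {S}

theorem up_p {Γ Ξ : C} (f : Ξ ⟶ Γ) (A : Disp S.D Γ) :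
    S.up f A ≫ A.p = (S.re A f).p ≫ f := (S.isPullback f A).w

/-- The 1-cell into `Ξ.A[f]` induced by `g : Ω ⟶ Γ.A` and `h : Ω ⟶ Ξ`. -/
noncomputable def lift {Γ Ξ Ω : C} {f : Ξ ⟶ Γ} {A : Disp S.D Γ} (g : Ω ⟶ A.obj) (h : Ω ⟶ Ξ)
    (w : g ≫ A.p = h ≫ f) : Ω ⟶ (S.re A f).obj :=
  (S.isPullback f A).lift g h w

@[simp] theorem lift_up {Γ Ξ Ω : C} {f : Ξ ⟶ Γ} {A : Disp S.D Γ} (g : Ω ⟶ A.obj) (h : Ω ⟶ Ξ)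
    (w : g ≫ A.p = h ≫ f) : lift g h w ≫ S.up f A = g :=
  (S.isPullback f A).lift_fst g h w

@[simp] theorem lift_p {Γ Ξ Ω : C} {f : Ξ ⟶ Γ} {A : Disp S.D Γ} (g : Ω ⟶ A.obj) (h : Ω ⟶ Ξ)
    (w : g ≫ A.p = h ≫ f) : lift g h w ≫ (S.re A f).p = h :=
  (S.isPullback f A).lift_snd g h w

theorem hom_ext {Γ Ξ Ω : C} {f : Ξ ⟶ Γ} {A : Disp S.D Γ} {x y : Ω ⟶ (S.re A f).obj}
    (h₁ : x ≫ S.up f A = y ≫ S.up f A) (h₂ : x ≫ (S.re A f).p = y ≫ (S.re A f).p) : x = y :=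
  (S.isPullback f A).hom_ext h₁ h₂

theorem arrow_mk_whiskerRight_whiskerRight {X Y Z W : C} {x y : X ⟶ Y} (c : x ⟶ y) (f : Y ⟶ Z)
    (g : Z ⟶ W) : Arrow.mk ((c ▷ f) ▷ g) = Arrow.mk (c ▷ (f ≫ g)) := by
  rw [Arrow.mk_eq_mk_iff]
  exact ⟨Category.assoc _ _ _, Category.assoc _ _ _, by
    simp [whiskerRight_comp, Strict.associator_eqToIso]⟩

theorem arrow_mk_conj {T : Type*} [Category T] {a b a' b' : T} (f : a ⟶ b) (h : a' = a)
    (k : b = b') : Arrow.mk (eqToHom h ≫ f ≫ eqToHom k) = Arrow.mk f := by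
  subst h; subst k; simp

theorem arrow_mk_eqToHom_comp {T : Type*} [Category T] {a b c : T} (h : a = b)
    (k : b = c) : Arrow.mk (eqToHom h ≫ eqToHom k) = Arrow.mk (𝟙 b) := by
  subst h; subst k; simp

theorem arrow_mk_whiskerRight_congr {X Y Z : C} {x y : X ⟶ Y} (c : x ⟶ y) {f g : Y ⟶ Z}
    (e : f = g) : Arrow.mk (c ▷ f) = Arrow.mk (c ▷ g) := by
  rw [e]

theorem cell_ext {Γ Ξ Ω : C} {f : Ξ ⟶ Γ} {A : Disp S.D Γ} {x y : Ω ⟶ (S.re A f).obj}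
    (c d : x ⟶ y) (h₁ : c ▷ S.up f A = d ▷ S.up f A)
    (h₂ : c ▷ (S.re A f).p = d ▷ (S.re A f).p) : c = d :=
  (S.isPullback₂ f A (d ▷ S.up f A) (d ▷ (S.re A f).p) (by
    rw [arrow_mk_whiskerRight_whiskerRight, arrow_mk_whiskerRight_whiskerRight]
    exact arrow_mk_whiskerRight_congr d (up_p f A))).unique ⟨h₁, h₂⟩ ⟨rfl, rfl⟩

/-- `1;u`: the section of `P_{A[f]}` induced by a 1-cell `u : f ⟶ P_A` of `C / Γ`. -/
noncomputable def secOf {Γ Ξ : C} {f : Ξ ⟶ Γ} {A : Disp S.D Γ} (u : SliceHom f A.p) :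
    S.Sec (S.re A f) :=
  ⟨lift u.map (𝟙 Ξ) (by rw [u.w, Category.id_comp]), lift_p _ _ _⟩

@[simp] theorem secOf_up {Γ Ξ : C} {f : Ξ ⟶ Γ} {A : Disp S.D Γ} (u : SliceHom f A.p) :
    (secOf u).map ≫ S.up f A = u.map := lift_up _ _ _

theorem secOf_map_exists {Γ Ξ : C} {f : Ξ ⟶ Γ} {A : Disp S.D Γ} {u v : SliceHom f A.p}
    (σ : u ⟶ v) : ∃ c : secOf u ⟶ secOf v,
      c.cell ▷ S.up f A = eqToHom (secOf_up u) ≫ σ.cell ≫ eqToHom (secOf_up v).symm := by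
  obtain ⟨c, ⟨h₁, h₂⟩, -⟩ := S.isPullback₂ f A (x := (secOf u).map) (y := (secOf v).map)
    (eqToHom (secOf_up u) ≫ σ.cell ≫ eqToHom (secOf_up v).symm)
    (eqToHom ((secOf u).w.trans (secOf v).w.symm)) (by
      have := σ.vertical
      rw [comp_whiskerRight, comp_whiskerRight, this, Arrow.mk_eq_mk_iff]
      exact ⟨by rw [Category.assoc, up_p, Category.assoc],
        by rw [Category.assoc, up_p, Category.assoc], by simp⟩)
  exact ⟨⟨c, h₂⟩, h₁⟩

variable (S) in
/-- The functor `1;_` from `(C / Γ)(f, P_A)` to the sections of `P_{A[f]}`. On a 2-cell `σ`, it is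
the unique vertical 2-cell that `f•` takes to `σ`. -/
noncomputable def sec {Γ Ξ : C} (f : Ξ ⟶ Γ) (A : Disp S.D Γ) :
    SliceHom f A.p ⥤ S.Sec (S.re A f) where
  obj u := secOf u
  map σ := (secOf_map_exists σ).choose
  map_id u := by
    ext
    refine cell_ext _ _ ?_ ?_
    · rw [(secOf_map_exists (𝟙 u)).choose_spec]; simp
    · rw [(secOf_map_exists (𝟙 u)).choose.vertical]; simp
  map_comp σ τ := by
    ext
    refine cell_ext _ _ ?_ ?_
    · rw [(secOf_map_exists (σ ≫ τ)).choose_spec]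
      simp [(secOf_map_exists σ).choose_spec, (secOf_map_exists τ).choose_spec]
    · rw [(secOf_map_exists (σ ≫ τ)).choose.vertical]
      simp [SliceHom.Hom.vertical]

theorem sec_map_up {Γ Ξ : C} {f : Ξ ⟶ Γ} {A : Disp S.D Γ} {u v : SliceHom f A.p}
    (σ : u ⟶ v) : ((S.sec f A).map σ).cell ▷ S.up f A =
      eqToHom (secOf_up u) ≫ σ.cell ≫ eqToHom (secOf_up v).symm :=
  (secOf_map_exists σ).choose_spec

variable (S) in
/-- Re-indexing of sections and of their 2-cells: `a ↦ a[f]`. -/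
noncomputable def secRe {Γ Ξ : C} (f : Ξ ⟶ Γ) (A : Disp S.D Γ) : S.Sec A ⥤ S.Sec (S.re A f) :=
  SliceHom.precomp f (Category.comp_id f) ⋙ S.sec f A

/-- The identification of the categories of sections of equal display maps. -/
def castSec {Γ : C} {A A' : Disp S.D Γ} (e : A = A') : S.Sec A ⥤ S.Sec A' := e ▸ 𝟭 (S.Sec A)

/-- `a;b : Γ ⟶ Γ.A.A▼`. -/
noncomputable def pair {Γ : C} {A : Disp S.D Γ} (a b : S.Sec A) : Γ ⟶ (S.wk A).obj :=
  lift b.map a.map (by rw [a.w, b.w])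

/-- For a 1-cell `g : f' ⟶ f` of `C / Γ`, the 1-cell `g• : Θ.A[f'] ⟶ Ξ.A[f]`,
where `A[f'] = A[f][g]`. -/
def bump {Γ Ξ Θ : C} (A : Disp S.D Γ) {f : Ξ ⟶ Γ} {f' : Θ ⟶ Γ} (g : Θ ⟶ Ξ) (e : g ≫ f = f') :
    (S.re A f').obj ⟶ (S.re A f).obj :=
  eqToHom (congrArg Disp.obj (by rw [← e, S.re_comp])) ≫ S.up g (S.re A f)

theorem bump_up {Γ Ξ Θ : C} (A : Disp S.D Γ) {f : Ξ ⟶ Γ} {f' : Θ ⟶ Γ} (g : Θ ⟶ Ξ)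
    (e : g ≫ f = f') : bump A g e ≫ S.up f A = S.up f' A := by
  subst e
  rw [S.up_comp, bump, Category.assoc]

theorem eqToHom_p {Γ : C} {A A' : Disp S.D Γ} (e : A = A') :
    eqToHom (congrArg Disp.obj e) ≫ A'.p = A.p := by
  subst e; simp

theorem bump_p {Γ Ξ Θ : C} (A : Disp S.D Γ) {f : Ξ ⟶ Γ} {f' : Θ ⟶ Γ} (g : Θ ⟶ Ξ)
    (e : g ≫ f = f') : bump A g e ≫ (S.re A f).p = (S.re A f').p ≫ g := by
  subst e
  rw [bump, Category.assoc, up_p, ← Category.assoc, eqToHom_p (S.re_comp g f A)]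

theorem wk_re {Γ Ξ : C} (f : Ξ ⟶ Γ) (A : Disp S.D Γ) :
    S.wk (S.re A f) = S.re (S.wk A) (S.up f A) := by
  rw [wk, wk, ← S.re_comp, ← S.re_comp, up_p]

variable (S) in
/-- `f•• : Ξ.A[f].A[f]▼ ⟶ Γ.A.A▼`, where `A[f]▼ = A▼[f•]`. -/
def up₂ {Γ Ξ : C} (f : Ξ ⟶ Γ) (A : Disp S.D Γ) : (S.wk (S.re A f)).obj ⟶ (S.wk A).obj :=
  eqToHom (congrArg Disp.obj (wk_re f A)) ≫ S.up (S.up f A) (S.wk A)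

/-- The source `P_{A▼} P_J` of an identity type `J` on `A`, over `Γ`. -/
def src {Γ : C} {A : Disp S.D Γ} (J : Disp S.D (S.wk A).obj) :
    SliceHom (J.p ≫ (S.wk A).p ≫ A.p) A.p :=
  ⟨J.p ≫ (S.wk A).p, Category.assoc _ _ _⟩

/-- The target `P_A• P_J` of an identity type `J` on `A`, over `Γ`. -/
def tgt {Γ : C} {A : Disp S.D Γ} (J : Disp S.D (S.wk A).obj) :
    SliceHom (J.p ≫ (S.wk A).p ≫ A.p) A.p :=
  ⟨J.p ≫ S.up A.p A, by rw [Category.assoc, up_p]⟩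

end SplitDisplay

namespace SplitDisplay

variable (S : SplitDisplay C)

/-- The identification of `(C / Γ.A)(1, P_B)` with `(C / Γ.A)(1_Γ•, P_B)`, where `1_Γ• = 1`. -/
def toOne {Γ : C} (A : Disp S.D Γ) (B : Disp S.D A.obj) :
    S.Sec B ⥤ SliceHom (S.up (𝟙 Γ) A) B.p :=
  SliceHom.precomp (S.up (𝟙 Γ) A) (Category.comp_id _)

/-- The identification of `(C / Γ.A)(1_Γ•, P_B)` with `(C / Γ.A)(1, P_B)`, where `1_Γ• = 1`. -/
def ofOne {Γ : C} (A : Disp S.D Γ) (B : Disp S.D A.obj) :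
    SliceHom (S.up (𝟙 Γ) A) B.p ⥤ S.Sec B :=
  SliceHom.precomp (eqToHom (congrArg Disp.obj (S.re_id A).symm)) (by simp [S.up_id])

variable {S}

theorem sec_ext {Γ Ξ : C} {f : Ξ ⟶ Γ} {A : Disp S.D Γ} {a b : S.Sec (S.re A f)}
    (h : a.map ≫ S.up f A = b.map ≫ S.up f A) : a = b :=
  SliceHom.ext (SplitDisplay.hom_ext h (a.w.trans b.w.symm))

theorem castSec_map {Γ : C} {A A' : Disp S.D Γ} (e : A = A') (a : S.Sec A) :
    ((castSec e).obj a).map = a.map ≫ eqToHom (congrArg Disp.obj e) := by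
  subst e; exact (Category.comp_id _).symm

theorem sec_obj_up {Γ Ξ : C} (f : Ξ ⟶ Γ) (A : Disp S.D Γ) (a : SliceHom f A.p) :
    ((S.sec f A).obj a).map ≫ S.up f A = a.map := secOf_up a

theorem secRe_obj_up {Γ Ξ : C} (f : Ξ ⟶ Γ) (A : Disp S.D Γ) (a : S.Sec A) :
    ((S.secRe f A).obj a).map ≫ S.up f A = f ≫ a.map := secOf_up _

theorem ofOne_toOne {Γ : C} (A : Disp S.D Γ) (B : Disp S.D A.obj) (a : S.Sec B) :
    (S.ofOne A B).obj ((S.toOne A B).obj a) = a := by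
  refine SliceHom.ext ?_
  simp [ofOne, toOne, SliceHom.precomp, S.up_id]

theorem eqToHom_up {Γ Ξ : C} {f f' : Ξ ⟶ Γ} (A : Disp S.D Γ) (e : f' = f) :
    eqToHom (congrArg Disp.obj (congrArg (S.re A) e)) ≫ S.up f A = S.up f' A := by
  subst e; simp

theorem pair_up {Γ : C} {A : Disp S.D Γ} (a b : S.Sec A) : pair a b ≫ S.up A.p A = b.map :=
  lift_up _ _ _

theorem pair_p {Γ : C} {A : Disp S.D Γ} (a b : S.Sec A) : pair a b ≫ (S.wk A).p = a.map :=
  lift_p _ _ _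

theorem up₂_p {Γ Ξ : C} (f : Ξ ⟶ Γ) (A : Disp S.D Γ) :
    S.up₂ f A ≫ (S.wk A).p = (S.wk (S.re A f)).p ≫ S.up f A := by
  rw [up₂, Category.assoc, up_p, ← Category.assoc, eqToHom_p (wk_re f A)]

theorem up₂_up {Γ Ξ : C} (f : Ξ ⟶ Γ) (A : Disp S.D Γ) :
    S.up₂ f A ≫ S.up A.p A = S.up (S.re A f).p (S.re A f) ≫ S.up f A := by
  have h₁ := S.up_comp (S.up f A) A.p A
  have h₂ := S.up_comp (S.re A f).p f A
  have h₃ := eqToHom_up A (up_p f A)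
  rw [h₁, h₂] at h₃
  rw [up₂, Category.assoc, ← cancel_epi (eqToHom (congrArg Disp.obj
    (S.re_comp (S.re A f).p f A))), ← cancel_epi (eqToHom (congrArg Disp.obj (congrArg (S.re A)
    (up_p f A)))), h₃]
  simp

/-- The square relating `a;b` and `a[f];b[f]`. -/
theorem pair_up₂ {Γ Ξ : C} (f : Ξ ⟶ Γ) (A : Disp S.D Γ) (a b : S.Sec A) :
    pair ((S.secRe f A).obj a) ((S.secRe f A).obj b) ≫ S.up₂ f A = f ≫ pair a b := by
  refine SplitDisplay.hom_ext ?_ ?_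
  · rw [Category.assoc, up₂_up, ← Category.assoc, pair_up, secRe_obj_up, Category.assoc, pair_up]
  · rw [Category.assoc, up₂_p, ← Category.assoc, pair_p, secRe_obj_up, Category.assoc, pair_p]

/-- `a[u]` as a section of `P_{B[v']}`, where `v' = v u`. -/
theorem castSec_secRe_up {Γ Ξ Θ : C} {B : Disp S.D Γ} {v : Ξ ⟶ Γ} {u : Θ ⟶ Ξ} {v' : Θ ⟶ Γ}
    (e : u ≫ v = v') (eD : S.re (S.re B v) u = S.re B v') (a : S.Sec (S.re B v)) :
    ((castSec eD).obj ((S.secRe u (S.re B v)).obj a)).map ≫ S.up v' B =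
      u ≫ a.map ≫ S.up v B := by
  subst e
  rw [castSec_map, S.up_comp, ← Category.assoc u, ← secRe_obj_up]
  simp

theorem bump_comp {Γ Ξ Θ Λ : C} (A : Disp S.D Γ) {f : Ξ ⟶ Γ} {f' : Θ ⟶ Γ} {f'' : Λ ⟶ Γ}
    (k : Λ ⟶ Θ) (g : Θ ⟶ Ξ) (e : g ≫ f = f') (e' : k ≫ f' = f'') (e'' : (k ≫ g) ≫ f = f'') :
    bump A (k ≫ g) e'' = bump A k e' ≫ bump A g e := by
  refine SplitDisplay.hom_ext ?_ ?_
  · rw [Category.assoc, bump_up, bump_up, bump_up]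
  · rw [Category.assoc, bump_p, bump_p, ← Category.assoc (bump A k e'), bump_p, Category.assoc]

end SplitDisplay

open SplitDisplay

variable [IsLocallyGroupoid C]

/-- Axiomatic `=`-types. -/
structure AxiomaticId (S : DisplayMap2Category C) where
  /-- The display map `Γ.A.A▼.Id_A ⟶ Γ.A.A▼`. -/
  Id : ∀ {Γ : C} (A : Disp S.D Γ), Disp S.D (S.wk A).obj
  /-- The 2-cell `α_A : P_{A▼} P_{Id_A} ⟶ P_A• P_{Id_A}` of `C / Γ`. -/
  α : ∀ {Γ : C} (A : Disp S.D Γ), src (Id A) ⟶ tgt (Id A)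
  isArrowObject : ∀ {Γ : C} (A : Disp S.D Γ), SliceHom.IsArrowObject (α A)
  Id_re : ∀ {Γ Ξ : C} (f : Ξ ⟶ Γ) (A : Disp S.D Γ), S.re (Id A) (S.up₂ f A) = Id (S.re A f)
  /-- `α_A[f] = α_{A[f]}`: the vertical 2-cell `α_{A[f]}` is taken by `f•` to the restriction of
  `α_A` along `f•••`. -/
  α_re : ∀ {Γ Ξ : C} (f : Ξ ⟶ Γ) (A : Disp S.D Γ),
    Arrow.mk ((α (S.re A f)).cell ▷ S.up f A) =
      Arrow.mk ((eqToHom (congrArg Disp.obj (Id_re f A).symm) ≫ S.up (S.up₂ f A) (Id A)) ◁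
        (α A).cell)

namespace AxiomaticId

variable {S : DisplayMap2Category C} (I : AxiomaticId S)

/-- The composite display map `Γ.A.A▼.Id_A ⟶ Γ`. -/
abbrev base {Γ : C} (A : Disp S.D Γ) : (I.Id A).obj ⟶ Γ := (I.Id A).p ≫ (S.wk A).p ≫ A.p

/-- `s_A = P_{A▼} P_{Id_A}`, as a 1-cell over `Γ`. -/
abbrev s {Γ : C} (A : Disp S.D Γ) : SliceHom (I.base A) A.p := src (I.Id A)

/-- `t_A = P_A• P_{Id_A}`, as a 1-cell over `Γ`. -/
abbrev t {Γ : C} (A : Disp S.D Γ) : SliceHom (I.base A) A.p := tgt (I.Id A)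

/-- `f••• : Ξ.A'.A'▼.Id_{A'} ⟶ Γ.A.A▼.Id_A`, where `A' = A[f]`. -/
def up₃ {Γ Ξ : C} (f : Ξ ⟶ Γ) {A : Disp S.D Γ} {A' : Disp S.D Ξ} (e : A' = S.re A f) :
    (I.Id A').obj ⟶ (I.Id A).obj :=
  eqToHom (by rw [e, I.Id_re f A]) ≫ S.up (S.up₂ f A) (I.Id A)

/-- The unique 1-cell `p` over `Γ` whose composite with `α_A` is `σ`. -/
noncomputable def tilde {Γ X : C} {A : Disp S.D Γ} {h : X ⟶ Γ} {a b : SliceHom h A.p}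
    (σ : a ⟶ b) : SliceHom h (I.base A) :=
  ((I.isArrowObject A h).1.surjective (Arrow.mk σ)).choose

section

variable {Γ X : C} {A : Disp S.D Γ} {h : X ⟶ Γ} {a b : SliceHom h A.p} (σ : a ⟶ b)

theorem tilde_spec : (SliceHom.arrowComparison (I.α A) h).obj (I.tilde σ) = Arrow.mk σ :=
  ((I.isArrowObject A h).1.surjective (Arrow.mk σ)).choose_spec

theorem tilde_src : (I.tilde σ).map ≫ (I.s A).map = a.map :=
  congrArg (fun x : Arrow (SliceHom h A.p) => x.left.map) (I.tilde_spec σ)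

theorem tilde_tgt : (I.tilde σ).map ≫ (I.t A).map = b.map :=
  congrArg (fun x : Arrow (SliceHom h A.p) => x.right.map) (I.tilde_spec σ)

theorem tilde_cell : Arrow.mk ((I.tilde σ).map ◁ (I.α A).cell) = Arrow.mk σ.cell :=
  congrArg (fun x : Arrow (SliceHom h A.p) => Arrow.mk x.hom.cell) (I.tilde_spec σ)

end

/-- `{σ}`: the section of `P_{Id_A[a;b]}` induced by a 2-cell `σ : a ⟶ b` of sections of `P_A`. -/
noncomputable def curly {Γ : C} {A : Disp S.D Γ} {a b : S.Sec A} (σ : a ⟶ b) :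
    S.Sec (S.re (I.Id A) (pair a b)) :=
  (S.sec (pair a b) (I.Id A)).obj ⟨(I.tilde σ).map, by
    refine SplitDisplay.hom_ext ?_ ?_
    · rw [Category.assoc, pair, lift_up]; exact I.tilde_tgt σ
    · rw [Category.assoc, pair, lift_p]; exact I.tilde_src σ⟩

/-- `r_A`: the 1-cell whose composite with `α_A` is the identity 2-cell. -/
noncomputable def r {Γ : C} (A : Disp S.D Γ) : SliceHom A.p (I.base A) :=
  I.tilde (𝟙 (⟨𝟙 A.obj, Category.id_comp _⟩ : SliceHom A.p A.p))

theorem r_src {Γ : C} (A : Disp S.D Γ) : (I.r A).map ≫ (I.s A).map = 𝟙 A.obj := I.tilde_src _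

theorem r_tgt {Γ : C} (A : Disp S.D Γ) : (I.r A).map ≫ (I.t A).map = 𝟙 A.obj := I.tilde_tgt _

theorem r_cell {Γ : C} (A : Disp S.D Γ) :
    Arrow.mk ((I.r A).map ◁ (I.α A).cell) = Arrow.mk (𝟙 (𝟙 A.obj)) := I.tilde_cell _

theorem φ_exists {Γ : C} (A : Disp S.D Γ) :
    ∃ φ : 𝟙 (I.Id A).obj ⟶ (I.t A).map ≫ (I.r A).map,
      Arrow.mk (φ ▷ (I.s A).map) = Arrow.mk (I.α A).cell ∧
      Arrow.mk (φ ▷ (I.t A).map) = Arrow.mk (𝟙 (I.t A).map) := by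
  have e₁ := I.r_src A
  have e₂ := I.r_tgt A
  let U : SliceHom (I.base A) (I.base A) := ⟨𝟙 _, Category.id_comp _⟩
  let V : SliceHom (I.base A) (I.base A) :=
    ⟨(I.t A).map ≫ (I.r A).map, by rw [Category.assoc, (I.r A).w, (I.t A).w]⟩
  have es : (SliceHom.precomp U.map U.w).obj (I.s A) = I.s A :=
    SliceHom.ext (Category.id_comp _)
  have et : (SliceHom.precomp U.map U.w).obj (I.t A) = I.t A :=
    SliceHom.ext (Category.id_comp _)
  have es' : (SliceHom.precomp V.map V.w).obj (I.s A) = I.t A :=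
    SliceHom.ext (show ((I.t A).map ≫ (I.r A).map) ≫ (I.s A).map = _ by
      rw [Category.assoc, e₁, Category.comp_id])
  have et' : (SliceHom.precomp V.map V.w).obj (I.t A) = I.t A :=
    SliceHom.ext (show ((I.t A).map ≫ (I.r A).map) ≫ (I.t A).map = _ by
      rw [Category.assoc, e₂, Category.comp_id])
  have sq : (eqToHom es ≫ I.α A ≫ eqToHom es'.symm) ≫ (SliceHom.precomp V.map V.w).map (I.α A) =
      (SliceHom.precomp U.map U.w).map (I.α A) ≫ eqToHom et ≫ eqToHom et'.symm := by
    obtain ⟨h₁, h₂, h₃⟩ := (Arrow.mk_eq_mk_iff _ _).1 (I.r_cell A)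
    ext
    simp only [SliceHom.comp_cell, SliceHom.eqToHom_cell]
    simp [SliceHom.precomp, comp_whiskerLeft, h₃, U, V,
      Strict.associator_eqToIso, Strict.leftUnitor_eqToIso]
    erw [eqToHom_trans, eqToHom_trans, eqToHom_trans]
  have := (I.isArrowObject A (I.base A)).2.1
  obtain ⟨φ, hφ⟩ := Functor.map_surjective
    (SliceHom.arrowComparison (I.α A) (I.base A)) (X := U) (Y := V)
    (Arrow.homMk (eqToHom es ≫ I.α A ≫ eqToHom es'.symm) (eqToHom et ≫ eqToHom et'.symm) sq)
  refine ⟨φ.cell, ?_, ?_⟩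
  · have h : φ.cell ▷ (I.s A).map = (eqToHom es ≫ I.α A ≫ eqToHom es'.symm).cell :=
      congrArg (fun x => x.left.cell) hφ
    rw [h]
    simp only [SliceHom.comp_cell, SliceHom.eqToHom_cell]
    exact arrow_mk_conj _ _ _
  · have h : φ.cell ▷ (I.t A).map = (eqToHom et ≫ eqToHom et'.symm).cell :=
      congrArg (fun x => x.right.cell) hφ
    rw [h]
    simp only [SliceHom.comp_cell, SliceHom.eqToHom_cell]
    exact arrow_mk_eqToHom_comp _ _

/-- `φ_A : 1 ⟶ r_A (P_A• P_{Id_A})`: the unique 2-cell over `Γ` whose restrictions to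
the source and to the target are `α_A` and the identity. -/
noncomputable def φ {Γ : C} (A : Disp S.D Γ) :
    𝟙 (I.Id A).obj ⟶ (I.t A).map ≫ (I.r A).map := (I.φ_exists A).choose

/-- The elimination term `J_c`: the lift of `φ_A` to the pseudo-term `r_A• c (P_A• P_{Id_A})`. -/
noncomputable def J {Γ : C} {A : Disp S.D Γ} (Q : Disp S.D (I.Id A).obj)
    (c : S.Sec (S.re Q (I.r A).map)) : S.Sec Q :=
  ⟨S.t Q ((I.t A).map ≫ c.map ≫ S.up (I.r A).map Q) (I.φ A ≫ eqToHom (by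
      rw [Category.assoc, Category.assoc, up_p, ← Category.assoc c.map, c.w, Category.id_comp])),
    S.t_p Q _ _⟩

end AxiomaticId

/-- Axiomatic `Π`-types and axiomatic function extensionality. -/
structure AxiomaticPi (S : DisplayMap2Category C) where
  /-- The display map `Γ.Π_A^B ⟶ Γ`. -/
  Pi : ∀ {Γ : C} (A : Disp S.D Γ), Disp S.D A.obj → Disp S.D Γ
  Pi_re : ∀ {Γ Ξ : C} (f : Ξ ⟶ Γ) (A : Disp S.D Γ) (B : Disp S.D A.obj),
    S.re (Pi A B) f = Pi (S.re A f) (S.re B (S.up f A))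
  lam : ∀ {Γ Ξ : C} (A : Disp S.D Γ) (B : Disp S.D A.obj) (f : Ξ ⟶ Γ),
    SliceHom (S.up f A) B.p ⥤ SliceHom f (Pi A B).p
  app : ∀ {Γ Ξ : C} (A : Disp S.D Γ) (B : Disp S.D A.obj) (f : Ξ ⟶ Γ),
    SliceHom f (Pi A B).p ⥤ SliceHom (S.up f A) B.p
  β : ∀ {Γ Ξ : C} (A : Disp S.D Γ) (B : Disp S.D A.obj) (f : Ξ ⟶ Γ),
    lam A B f ⋙ app A B f ≅ 𝟭 (SliceHom (S.up f A) B.p)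
  η : ∀ {Γ Ξ : C} (A : Disp S.D Γ) (B : Disp S.D A.obj) (f : Ξ ⟶ Γ),
    𝟭 (SliceHom f (Pi A B).p) ≅ app A B f ⋙ lam A B f
  /-- Naturality along `g : f' ⟶ f` in `C / Γ`. -/
  lam_precomp : ∀ {Γ Ξ Θ : C} (A : Disp S.D Γ) (B : Disp S.D A.obj) {f : Ξ ⟶ Γ} {f' : Θ ⟶ Γ}
    (g : Θ ⟶ Ξ) (e : g ≫ f = f'),
    lam A B f ⋙ SliceHom.precomp g e =
      SliceHom.precomp (bump A g e) (bump_up A g e) ⋙ lam A B f'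
  app_precomp : ∀ {Γ Ξ Θ : C} (A : Disp S.D Γ) (B : Disp S.D A.obj) {f : Ξ ⟶ Γ} {f' : Θ ⟶ Γ}
    (g : Θ ⟶ Ξ) (e : g ≫ f = f'),
    app A B f ⋙ SliceHom.precomp (bump A g e) (bump_up A g e) =
      SliceHom.precomp g e ⋙ app A B f'
  β_precomp : ∀ {Γ Ξ Θ : C} (A : Disp S.D Γ) (B : Disp S.D A.obj) {f : Ξ ⟶ Γ} {f' : Θ ⟶ Γ}
    (g : Θ ⟶ Ξ) (e : g ≫ f = f') (h : SliceHom (S.up f A) B.p),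
    Arrow.mk ((SliceHom.precomp (bump A g e) (bump_up A g e)).map ((β A B f).hom.app h)) =
      Arrow.mk ((β A B f').hom.app
        ((SliceHom.precomp (bump A g e) (bump_up A g e)).obj h))
  η_precomp : ∀ {Γ Ξ Θ : C} (A : Disp S.D Γ) (B : Disp S.D A.obj) {f : Ξ ⟶ Γ} {f' : Θ ⟶ Γ}
    (g : Θ ⟶ Ξ) (e : g ≫ f = f') (k : SliceHom f (Pi A B).p),
    Arrow.mk ((SliceHom.precomp g e).map ((η A B f).hom.app k)) =
      Arrow.mk ((η A B f').hom.app ((SliceHom.precomp g e).obj k))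
  /-- Compatibility with re-indexing along `f`. -/
  lam_re : ∀ {Γ Ξ : C} (A : Disp S.D Γ) (B : Disp S.D A.obj) (f : Ξ ⟶ Γ),
    lam A B f ⋙ S.sec f (Pi A B) ⋙ castSec (Pi_re f A B) =
      S.sec (S.up f A) B ⋙ S.toOne (S.re A f) (S.re B (S.up f A)) ⋙
        lam (S.re A f) (S.re B (S.up f A)) (𝟙 Ξ)
  app_re : ∀ {Γ Ξ : C} (A : Disp S.D Γ) (B : Disp S.D A.obj) (f : Ξ ⟶ Γ),
    app A B f ⋙ S.sec (S.up f A) B ⋙ S.toOne (S.re A f) (S.re B (S.up f A)) =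
      S.sec f (Pi A B) ⋙ castSec (Pi_re f A B) ⋙
        app (S.re A f) (S.re B (S.up f A)) (𝟙 Ξ)
  β_re : ∀ {Γ Ξ : C} (A : Disp S.D Γ) (B : Disp S.D A.obj) (f : Ξ ⟶ Γ)
    (h : SliceHom (S.up f A) B.p),
    Arrow.mk ((S.sec (S.up f A) B ⋙ S.toOne (S.re A f) (S.re B (S.up f A))).map
        ((β A B f).hom.app h)) =
      Arrow.mk ((β (S.re A f) (S.re B (S.up f A)) (𝟙 Ξ)).hom.app
        ((S.sec (S.up f A) B ⋙ S.toOne (S.re A f) (S.re B (S.up f A))).obj h))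
  η_re : ∀ {Γ Ξ : C} (A : Disp S.D Γ) (B : Disp S.D A.obj) (f : Ξ ⟶ Γ)
    (k : SliceHom f (Pi A B).p),
    Arrow.mk ((S.sec f (Pi A B) ⋙ castSec (Pi_re f A B)).map ((η A B f).hom.app k)) =
      Arrow.mk ((η (S.re A f) (S.re B (S.up f A)) (𝟙 Ξ)).hom.app
        ((S.sec f (Pi A B) ⋙ castSec (Pi_re f A B)).obj k))

namespace AxiomaticPi

variable {S : DisplayMap2Category C} (P : AxiomaticPi S)
variable {Γ : C} (A : Disp S.D Γ) (B : Disp S.D A.obj)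

/-- `λ_A^B` on sections of `P_B`. -/
def lamSec : S.Sec B ⥤ S.Sec (P.Pi A B) := S.toOne A B ⋙ P.lam A B (𝟙 Γ)

/-- `app_A^B` on sections of `P_{Π_A^B}`. -/
def appSec : S.Sec (P.Pi A B) ⥤ S.Sec B := P.app A B (𝟙 Γ) ⋙ S.ofOne A B

/-- `ev_A^B = 1;app_A^B(1)`, a section of `P_{B[P_Π•]}`. -/
noncomputable def ev : S.Sec (S.re B (S.up (P.Pi A B).p A)) :=
  (S.sec (S.up (P.Pi A B).p A) B).obj
    ((P.app A B (P.Pi A B).p).obj ⟨𝟙 (P.Pi A B).obj, Category.id_comp _⟩)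

variable {A B}

/-- `ev_A^B[z•]`, for a 1-cell `z : h ⟶ P_Π` of `C / Γ`, as a section of `P_{B[h•]}`, where
`B[h•] = B[P_Π•][z•]`. -/
noncomputable def evAt {Ξ : C} {h : Ξ ⟶ Γ} (z : SliceHom h (P.Pi A B).p) :
    S.Sec (S.re B (S.up h A)) :=
  (castSec (by rw [← S.re_comp, bump_up])).obj
    ((S.secRe (bump A z.map z.w) (S.re B (S.up (P.Pi A B).p A))).obj (P.ev A B))

theorem evAt_up {Ξ : C} {h : Ξ ⟶ Γ} (z : SliceHom h (P.Pi A B).p) :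
    (P.evAt z).map ≫ S.up (S.up h A) B = bump A z.map z.w ≫
      ((P.app A B (P.Pi A B).p).obj ⟨𝟙 (P.Pi A B).obj, Category.id_comp _⟩).map := by
  rw [evAt, castSec_secRe_up (bump_up A z.map z.w)]
  congr 1
  exact sec_obj_up _ _ _

theorem appSec_sec {Ξ : C} {h : Ξ ⟶ Γ} (z : SliceHom h (P.Pi A B).p) :
    (P.appSec (S.re A h) (S.re B (S.up h A))).obj
      ((castSec (P.Pi_re h A B)).obj ((S.sec h (P.Pi A B)).obj z)) = P.evAt z := by
  have h₁ := congrArg (fun F => F.obj z) (P.app_re A B h)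
  have h₂ := congrArg (fun F => F.obj ⟨𝟙 (P.Pi A B).obj, Category.id_comp _⟩)
    (P.app_precomp A B z.map z.w)
  have h₃ : (SliceHom.precomp z.map z.w).obj
      (⟨𝟙 (P.Pi A B).obj, Category.id_comp _⟩ : SliceHom (P.Pi A B).p (P.Pi A B).p) = z :=
    SliceHom.ext (Category.comp_id _)
  simp only [Functor.comp_obj] at h₁ h₂
  rw [h₃] at h₂
  rw [appSec, Functor.comp_obj, ← h₁, ofOne_toOne]
  refine sec_ext ?_
  rw [sec_obj_up, evAt_up, ← h₂]
  rfl

theorem evAt_one : P.evAt (A := A) (B := B) ⟨𝟙 (P.Pi A B).obj, Category.id_comp _⟩ =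
    P.ev A B := by
  refine sec_ext ?_
  rw [evAt_up, ev, sec_obj_up]
  have h : bump A (𝟙 (P.Pi A B).obj) (Category.id_comp (P.Pi A B).p) = 𝟙 _ :=
    SplitDisplay.hom_ext (by rw [bump_up, Category.id_comp])
      (by rw [bump_p, Category.comp_id, Category.id_comp])
  exact (congrArg (· ≫ _) h).trans (Category.id_comp _)

theorem evAt_precomp {Ξ Θ : C} {h : Ξ ⟶ Γ} {h' : Θ ⟶ Γ} (z : SliceHom h (P.Pi A B).p)
    (g : Θ ⟶ Ξ) (e : g ≫ h = h')
    (eD : S.re (S.re B (S.up h A)) (bump A g e) = S.re B (S.up h' A)) :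
    P.evAt ((SliceHom.precomp g e).obj z) =
      (castSec eD).obj ((S.secRe (bump A g e) (S.re B (S.up h A))).obj (P.evAt z)) := by
  refine sec_ext ?_
  rw [castSec_secRe_up (bump_up A g e), evAt_up, evAt_up]
  exact (congrArg (· ≫ _) (bump_comp A g z.map z.w e _)).trans (Category.assoc _ _ _)

theorem Pi_congr {A' : Disp S.D Γ} (e : A' = A) (B' : Disp S.D A'.obj)
    (h : B' = S.re B (eqToHom (congrArg Disp.obj e))) : P.Pi A' B' = P.Pi A B := by
  subst e
  rw [h, eqToHom_refl, S.re_id]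

variable (I : AxiomaticId S)

theorem re_pair {Ξ : C} {u : Ξ ⟶ Γ} {A' : Disp S.D Ξ}
    (e : S.re A u = A') (a b : S.Sec A) :
    S.re (I.Id A') (pair ((castSec e).obj ((S.secRe u A).obj a))
      ((castSec e).obj ((S.secRe u A).obj b))) = S.re (S.re (I.Id A) (pair a b)) u := by
  subst e
  rw [← S.re_comp, ← pair_up₂, S.re_comp, I.Id_re]
  rfl

/-- The display map `Π_{A[h]}^{Id_{B[h•]}[ev[z•];ev[z'•]]}` over `Ξ`, for 1-cells
`z, z' : h ⟶ P_Π` of `C / Γ`. -/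
noncomputable def happlyTy (I : AxiomaticId S) {Ξ : C} {h : Ξ ⟶ Γ}
    (z z' : SliceHom h (P.Pi A B).p) : Disp S.D Ξ :=
  P.Pi (S.re A h) (S.re (I.Id (S.re B (S.up h A))) (pair (P.evAt z) (P.evAt z')))

theorem happlyTy_re {Ξ Θ : C} {h : Ξ ⟶ Γ} {h' : Θ ⟶ Γ} (z z' : SliceHom h (P.Pi A B).p)
    (g : Θ ⟶ Ξ) (e : g ≫ h = h') : S.re (P.happlyTy I z z') g =
      P.happlyTy I ((SliceHom.precomp g e).obj z) ((SliceHom.precomp g e).obj z') := by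
  have eD : S.re (S.re B (S.up h A)) (bump A g e) = S.re B (S.up h' A) := by
    rw [← S.re_comp, bump_up]
  rw [happlyTy, P.Pi_re]
  symm
  refine P.Pi_congr (by rw [← e, S.re_comp]) _ ?_
  rw [P.evAt_precomp z g e eD, P.evAt_precomp z' g e eD, re_pair I, ← S.re_comp _ (S.up g _)]
  rfl

variable (A B)

/-- The object `Γ.Π_A^B.(Π_A^B)▼.Id_{Π_A^B}`. -/
abbrev idObj : C := (I.Id (P.Pi A B)).obj

/-- The display map `Π_{A[P_Π s]}^{Id_{B[(P_Π s)•]}[ev[s•];ev[t•]]}` over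
`Γ.Π_A^B.(Π_A^B)▼.Id_{Π_A^B}`. -/
noncomputable def T : Disp S.D (P.idObj A B I) :=
  P.Pi (S.re A (I.base (P.Pi A B)))
    (S.re (I.Id (S.re B (S.up (I.base (P.Pi A B)) A)))
      (pair (P.evAt (I.s (P.Pi A B))) (P.evAt (I.t (P.Pi A B)))))

/-- The display map `Π_{A[P_Π]}^{Id_{B[P_Π•]}[ev;ev]}` over `Γ.Π_A^B` is `T[r_Π]`. -/
theorem T_r :
    P.Pi (S.re A (P.Pi A B).p)
      (S.re (I.Id (S.re B (S.up (P.Pi A B).p A))) (pair (P.ev A B) (P.ev A B))) =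
    S.re (P.T A B I) (I.r (P.Pi A B)).map := by
  have hs : (SliceHom.precomp (I.r (P.Pi A B)).map (I.r (P.Pi A B)).w).obj (I.s (P.Pi A B)) =
      ⟨𝟙 _, Category.id_comp _⟩ := SliceHom.ext (I.r_src _)
  have ht : (SliceHom.precomp (I.r (P.Pi A B)).map (I.r (P.Pi A B)).w).obj (I.t (P.Pi A B)) =
      ⟨𝟙 _, Category.id_comp _⟩ := SliceHom.ext (I.r_tgt _)
  refine Eq.trans ?_ (P.happlyTy_re I (I.s (P.Pi A B)) (I.t (P.Pi A B))
    (I.r (P.Pi A B)).map (I.r (P.Pi A B)).w).symm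
  rw [hs, ht, happlyTy, evAt_one]

/-- `r_{B[P_Π•]}[ev]`: the section of `P_{Id_{B[P_Π•]}[ev;ev]}` which `(ev;ev)•` takes to
`r_{B[P_Π•]} ev`. -/
noncomputable def rEv : S.Sec (S.re (I.Id (S.re B (S.up (P.Pi A B).p A)))
    (pair (P.ev A B) (P.ev A B))) :=
  (S.sec _ _).obj ⟨(P.ev A B).map ≫ (I.r _).map, by
    refine SplitDisplay.hom_ext ?_ ?_
    · rw [pair_up, Category.assoc, Category.assoc]
      exact (congrArg _ (I.r_tgt _)).trans (Category.comp_id _)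
    · rw [pair_p, Category.assoc, Category.assoc]
      exact (congrArg _ (I.r_src _)).trans (Category.comp_id _)⟩

/-- `happly = J_{abst r_{B[P_Π•]}[ev]}`, a section of `P_T`. -/
noncomputable def happly : S.Sec (P.T A B I) :=
  I.J (P.T A B I) ((castSec (P.T_r A B I)).obj ((P.lamSec _ _).obj (P.rEv A B I)))

/-- The re-indexing `α̃` of `α_Π` along `P_Π s`, with source `s̃` and target `t̃`. -/
noncomputable def αTilde :=
  (S.sec (I.base (P.Pi A B)) (P.Pi A B) ⋙ castSec (P.Pi_re (I.base (P.Pi A B)) A B)).map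
    (I.α (P.Pi A B))

/-- `happ = {app α̃}`, where `app s̃ = ev[s•]` and `app t̃ = ev[t•]`. -/
noncomputable def happ : S.Sec (S.re (I.Id (S.re B (S.up (I.base (P.Pi A B)) A)))
    (pair (P.evAt (I.s (P.Pi A B))) (P.evAt (I.t (P.Pi A B))))) :=
  (castSec (by
    rw [← P.appSec_sec (I.s (P.Pi A B)), ← P.appSec_sec (I.t (P.Pi A B))]; rfl)).obj
    (I.curly ((P.appSec _ _).map (P.αTilde A B I)))

/-- `λ happ`, a section of `P_T`. -/
noncomputable def lamHapp : S.Sec (P.T A B I) := (P.lamSec _ _).obj (P.happ A B I)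

/-- `f••• : Ξ.Π'.Π'▼.Id_{Π'} ⟶ Γ.Π.Π▼.Id_Π`, where `Π = Π_A^B` and
`Π' = Π_{A[f]}^{B[f•]} = Π[f]`. -/
def reIdx {Ξ : C} (f : Ξ ⟶ Γ) : P.idObj (S.re A f) (S.re B (S.up f A)) I ⟶ P.idObj A B I :=
  I.up₃ f (P.Pi_re f A B).symm

end AxiomaticPi

end Slice
end DisplayMap

/-! Write `r`, `s`, `t`, `φ`, `α` for the data of the identity type of `Π`, and `g*x` for
whiskering. Let `q` be any section of a display map `Q` over the total object of that identity type,
and suppose that `c = q[r]`, that is, `r•c = qr`. By definition `J_c` is the source of the chosen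
lift `τ : J_c ⇒ r•ct = qrt` of `φ : 1 ⇒ rt`. On the other hand `q*φ : q ⇒ qrt` also lies over `φ`,
because `q` is a section. Since 2-cells are invertible, `τ` followed by the inverse of `q*φ` is a
2-cell `J_c ⇒ q`, and it is vertical because both factors project to `φ`. This is `JHom`.

To obtain `θ`, take `q = λ happ`. The hypothesis to check (`lamHapp_r`) is that `λ happ` restricts
along `r` to the section `λ(r[ev])` from which `happly` is eliminated. Indeed `r` classifies an
identity 2-cell, so `α̃` restricts to an identity; `app` preserves identities, so `happ = {app α̃}`
restricts to `{1_ev}`, and this is `r[ev]` (`rEv_eq`).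

Stability holds because every ingredient is stable: the lifts `τ` by the cleavage axiom
(`τ_cart_three`), `φ` by the uniqueness part of the arrow object (`cart_top_φ`), and `λ happ`
because `app`, `{-}` and `λ` are (`lamHapp_cart`). `JHom_cart` assembles these.

Equalities of re-indexed objects hold only propositionally. Two devices absorb the resulting
transports: 2-cells are compared as objects of arrow categories (`wR`, `wL`), and `A' = A[g]` is
kept as a proposition `Cart g A' A` carrying its own 1-cell `top` over `g`. -/

namespace DisplayMap

open SplitDisplay

/-! ### Whiskering of 2-cells with unspecified endpoints -/

section Whiskering

variable {C : Type u} [Bicategory.{w, v} C]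

/-- Right whiskering of a 2-cell with unspecified source and target. -/
def wR {X Y Z : C} (f : Y ⟶ Z) (a : Arrow (X ⟶ Y)) : Arrow (X ⟶ Z) := Arrow.mk (a.hom ▷ f)

/-- Left whiskering of a 2-cell with unspecified source and target. -/
def wL {X Y Z : C} (f : X ⟶ Y) (a : Arrow (Y ⟶ Z)) : Arrow (X ⟶ Z) := Arrow.mk (f ◁ a.hom)

theorem wR_mk_id {X Y Z : C} (f : Y ⟶ Z) (x : X ⟶ Y) :
    wR f (Arrow.mk (𝟙 x)) = Arrow.mk (𝟙 (x ≫ f)) := by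
  simp [wR]

theorem wL_mk_id {X Y Z : C} (f : X ⟶ Y) (x : Y ⟶ Z) :
    wL f (Arrow.mk (𝟙 x)) = Arrow.mk (𝟙 (f ≫ x)) := by
  simp [wL]

variable [Bicategory.Strict C]

theorem wR_comp {X Y Z W : C} (f : Y ⟶ Z) (g : Z ⟶ W) (a : Arrow (X ⟶ Y)) :
    wR (f ≫ g) a = wR g (wR f a) :=
  (arrow_mk_whiskerRight_whiskerRight a.hom f g).symm

theorem wL_comp {X Y Z W : C} (f : X ⟶ Y) (g : Y ⟶ Z) (a : Arrow (Z ⟶ W)) :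
    wL (f ≫ g) a = wL f (wL g a) := by
  rw [wL, wL, wL, Arrow.mk_eq_mk_iff]
  exact ⟨Category.assoc _ _ _, Category.assoc _ _ _, by
    simp [comp_whiskerLeft, Strict.associator_eqToIso]⟩

theorem wL_wR {X Y Z W : C} (f : X ⟶ Y) (g : Z ⟶ W) (a : Arrow (Y ⟶ Z)) :
    wL f (wR g a) = wR g (wL f a) := by
  rw [wL, wL, wR, wR, Arrow.mk_eq_mk_iff]
  exact ⟨(Category.assoc _ _ _).symm, (Category.assoc _ _ _).symm, by
    simp [Strict.associator_eqToIso]⟩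

theorem wR_id {X Y : C} (a : Arrow (X ⟶ Y)) : wR (𝟙 Y) a = a := by
  obtain ⟨x, y, a⟩ := a
  change Arrow.mk _ = Arrow.mk a
  rw [Arrow.mk_eq_mk_iff]
  exact ⟨Category.comp_id _, Category.comp_id _, by
    simp [whiskerRight_id, Strict.rightUnitor_eqToIso]⟩

theorem wL_id {X Y : C} (a : Arrow (X ⟶ Y)) : wL (𝟙 X) a = a := by
  obtain ⟨x, y, a⟩ := a
  change Arrow.mk _ = Arrow.mk a
  rw [Arrow.mk_eq_mk_iff]
  exact ⟨Category.id_comp _, Category.id_comp _, by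
    simp [id_whiskerLeft, Strict.leftUnitor_eqToIso]⟩

end Whiskering

section ArrowCat

theorem arrow_mk_comp_eqToHom {T : Type*} [Category T] {a b b' : T} (f : a ⟶ b) (k : b = b') :
    Arrow.mk (f ≫ eqToHom k) = Arrow.mk f := by
  subst k; simp

theorem arrow_mk_eqToHom {T : Type*} [Category T] {a b : T} (h : a = b) :
    Arrow.mk (eqToHom h) = Arrow.mk (𝟙 b) := by
  subst h; simp

/-- The shape is that of the 2-cell in `JCell`: a lift followed by the inverse of a whiskered `φ`.
It lets such composites be compared one factor at a time. -/
theorem arrow_mk_comp_inv_congr {T : Type*} [Category T] {a b c d a' b' c' d' : T}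
    {f : a ⟶ b} {x : c ⟶ d} [IsIso x] {h : b = d} {f' : a' ⟶ b'} {x' : c' ⟶ d'} [IsIso x']
    {h' : b' = d'} (e₁ : Arrow.mk f = Arrow.mk f') (e₂ : Arrow.mk x = Arrow.mk x') :
    Arrow.mk (f ≫ eqToHom h ≫ inv x) = Arrow.mk (f' ≫ eqToHom h' ≫ inv x') := by
  obtain ⟨rfl, rfl, e₁⟩ := (Arrow.mk_eq_mk_iff _ _).1 e₁
  obtain ⟨rfl, rfl, e₂⟩ := (Arrow.mk_eq_mk_iff _ _).1 e₂
  subst h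
  simp at e₁ e₂
  subst e₁ e₂
  rfl

end ArrowCat

/-! ### Vertical 2-cells and re-indexed display maps -/

variable {C : Type u} [Bicategory.{w, v} C] [Bicategory.Strict C]

namespace SliceHom

variable {X X' Y Γ : C} {h : X ⟶ Γ} {p : Y ⟶ Γ}

theorem wR_cell {a b : SliceHom h p} (σ : a ⟶ b) : wR p (Arrow.mk σ.cell) = Arrow.mk (𝟙 h) := by
  have := b.w
  change Arrow.mk (σ.cell ▷ p) = _
  rw [σ.vertical, arrow_mk_eqToHom, b.w]

theorem arrow_mk_ext {a b a' b' : SliceHom h p} {σ : a ⟶ b} {σ' : a' ⟶ b'}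
    (e : Arrow.mk σ.cell = Arrow.mk σ'.cell) : Arrow.mk σ = Arrow.mk σ' := by
  obtain rfl : a = a' := SliceHom.ext (congrArg (·.left) e)
  obtain rfl : b = b' := SliceHom.ext (congrArg (·.right) e)
  obtain ⟨_, _, e⟩ := (Arrow.mk_eq_mk_iff _ _).1 e
  rw [show σ = σ' from hom_ext _ _ (by simpa using e)]

theorem arrow_mk_cell {a b a' b' : SliceHom h p} {σ : a ⟶ b} {σ' : a' ⟶ b'}
    (e : Arrow.mk σ = Arrow.mk σ') : Arrow.mk σ.cell = Arrow.mk σ'.cell :=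
  congrArg (fun x : Arrow (SliceHom h p) => Arrow.mk x.hom.cell) e

end SliceHom

/-- `A'` is the re-indexing `A[g]` of `A`. -/
def Cart {S : SplitDisplay C} {Θ Ξ : C} (g : Θ ⟶ Ξ) (A' : Disp S.D Θ) (A : Disp S.D Ξ) : Prop :=
  A' = S.re A g

namespace Cart

variable {S : SplitDisplay C} {Λ Θ Ξ Ω : C} {g : Θ ⟶ Ξ} {k : Λ ⟶ Θ}
  {A'' : Disp S.D Λ} {A' : Disp S.D Θ} {A : Disp S.D Ξ}

/-- The 1-cell `g• : Θ.A' ⟶ Ξ.A` over `g`. -/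
def top (c : Cart g A' A) : A'.obj ⟶ A.obj :=
  eqToHom (congrArg Disp.obj (show A' = S.re A g from c)) ≫ S.up g A

theorem of_re (g : Θ ⟶ Ξ) (A : Disp S.D Ξ) : Cart g (S.re A g) A := rfl

theorem of_re_top (g : Θ ⟶ Ξ) (A : Disp S.D Ξ) : (of_re g A).top = S.up g A :=
  Category.id_comp _

/-- `Cart` is a proposition, so `top` depends only on the 1-cell and the two display maps, never on
how the re-indexing was established. -/
theorem top_congr {g' : Θ ⟶ Ξ} (e : g = g') (c : Cart g A' A) (c' : Cart g' A' A) :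
    c.top = c'.top := by
  subst e; rfl

theorem congr {g' : Θ ⟶ Ξ} (c : Cart g A' A) (e : g = g') : Cart g' A' A := by
  subst e; exact c

theorem top_p (c : Cart g A' A) : c.top ≫ A.p = A'.p ≫ g := by
  obtain rfl := c
  rw [show top _ = S.up g A from of_re_top g A, up_p]

theorem hom_ext (c : Cart g A' A) {x y : Ω ⟶ A'.obj} (h₁ : x ≫ c.top = y ≫ c.top)
    (h₂ : x ≫ A'.p = y ≫ A'.p) : x = y := by
  obtain rfl := c
  rw [show top _ = S.up g A from of_re_top g A] at h₁
  exact SplitDisplay.hom_ext h₁ h₂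

/-- The one-dimensional pullback property first identifies the endpoints; only then does the
two-dimensional one apply. -/
theorem arrow_ext (c : Cart g A' A) {x y : Arrow (Ω ⟶ A'.obj)} (h₁ : wR c.top x = wR c.top y)
    (h₂ : wR A'.p x = wR A'.p y) : x = y := by
  obtain ⟨x₁, x₂, x⟩ := x
  obtain ⟨y₁, y₂, y⟩ := y
  obtain rfl : x₁ = y₁ := c.hom_ext (congrArg (·.left) h₁) (congrArg (·.left) h₂)
  obtain rfl : x₂ = y₂ := c.hom_ext (congrArg (·.right) h₁) (congrArg (·.right) h₂)
  obtain rfl := c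
  rw [show top _ = S.up g A from of_re_top g A] at h₁
  obtain ⟨_, _, h₁⟩ := (Arrow.mk_eq_mk_iff _ _).1 h₁
  obtain ⟨_, _, h₂⟩ := (Arrow.mk_eq_mk_iff _ _).1 h₂
  have : x = y := cell_ext _ _ (by simpa using h₁) (by simpa using h₂)
  subst this
  rfl

theorem comp (c : Cart g A' A) (d : Cart k A'' A') : Cart (k ≫ g) A'' A := by
  obtain rfl := c
  obtain rfl := d
  exact (S.re_comp k g A).symm

theorem comp_top (c : Cart g A' A) (d : Cart k A'' A') (e : Cart (k ≫ g) A'' A) :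
    e.top = d.top ≫ c.top := by
  obtain rfl := c
  obtain rfl := d
  change eqToHom _ ≫ _ = (eqToHom _ ≫ _) ≫ eqToHom _ ≫ _
  rw [S.up_comp]
  simp

/-- Cancellation for re-indexings of display maps. -/
theorem of_comp {f : Λ ⟶ Ξ} (c : Cart g A' A) (e : Cart f A'' A) (h : k ≫ g = f) :
    Cart k A'' A' := by
  obtain rfl := c
  obtain rfl := e
  subst h
  exact S.re_comp k g A

/-- The projections to the base are identities for vertical 2-cells, so only the component along
`g•` remains to be compared. -/
theorem sec_arrow_ext (c : Cart g A' A) {x y x' y' : S.Sec A'} {σ : x ⟶ y} {σ' : x' ⟶ y'}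
    (h : wR c.top (Arrow.mk σ.cell) = wR c.top (Arrow.mk σ'.cell)) :
    Arrow.mk σ = Arrow.mk σ' :=
  SliceHom.arrow_mk_ext (c.arrow_ext h (by rw [SliceHom.wR_cell, SliceHom.wR_cell]))

/-- The re-indexing of `A▼`. -/
theorem wk (c : Cart g A' A) : Cart c.top (S.wk A') (S.wk A) := by
  obtain rfl := c
  rw [show top _ = S.up g A from of_re_top g A]
  exact wk_re g A

theorem wk_top_p (c : Cart g A' A) : c.wk.top ≫ (S.wk A).p = (S.wk A').p ≫ c.top := c.wk.top_p

/-- Both sides exhibit `A'▼` as a re-indexing of `A`, along the two equal composites `c.top ≫ A.p`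
and `A'.p ≫ g`. -/
theorem wk_top_up (c : Cart g A' A) :
    c.wk.top ≫ S.up A.p A = S.up A'.p A' ≫ c.top := by
  have h₁ := comp_top (of_re A.p A) c.wk (comp (of_re A.p A) c.wk)
  have h₂ := comp_top c (of_re A'.p A') (comp c (of_re A'.p A'))
  rw [of_re_top] at h₁ h₂
  rw [← h₁, ← h₂]
  exact top_congr c.top_p _ _

theorem pair_wk_top (c : Cart g A' A) {a' b' : S.Sec A'} {a b : S.Sec A}
    (ha : a'.map ≫ c.top = g ≫ a.map) (hb : b'.map ≫ c.top = g ≫ b.map) :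
    pair a' b' ≫ c.wk.top = g ≫ pair a b := by
  refine SplitDisplay.hom_ext ?_ ?_
  · rw [Category.assoc, wk_top_up, ← Category.assoc, pair_up, Category.assoc, pair_up, hb]
  · rw [Category.assoc, wk_top_p, ← Category.assoc, pair_p, Category.assoc, pair_p, ha]

theorem of_re_wk_top (g : Θ ⟶ Ξ) (A : Disp S.D Ξ) : (of_re g A).wk.top = S.up₂ g A := by
  refine SplitDisplay.hom_ext ?_ ?_
  · rw [wk_top_up, up₂_up, of_re_top]
  · rw [wk_top_p, up₂_p, of_re_top]

end Cart

theorem sec_cell {S : SplitDisplay C} {Γ Ξ : C} {f : Ξ ⟶ Γ} {A : Disp S.D Γ}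
    {u v : SliceHom f A.p} (σ : u ⟶ v) :
    wR (S.up f A) (Arrow.mk ((S.sec f A).map σ).cell) = Arrow.mk σ.cell := by
  change Arrow.mk (((S.sec f A).map σ).cell ▷ S.up f A) = _
  rw [sec_map_up]
  exact arrow_mk_conj _ _ _

theorem sec_castSec_cell {S : SplitDisplay C} {Γ Ξ : C} {f : Ξ ⟶ Γ} {A : Disp S.D Γ}
    {A' : Disp S.D Ξ} (e : S.re A f = A') (c : Cart f A' A)
    {u v : SliceHom f A.p} (σ : u ⟶ v) :
    wR c.top (Arrow.mk ((S.sec f A ⋙ castSec e).map σ).cell) = Arrow.mk σ.cell := by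
  subst e
  rw [show c.top = S.up f A from Cart.of_re_top f A]
  exact sec_cell σ

theorem secRe_castSec_cell {S : SplitDisplay C} {Γ Ξ : C} {f : Ξ ⟶ Γ} {A : Disp S.D Γ}
    {A' : Disp S.D Ξ} (e : S.re A f = A') (c : Cart f A' A)
    {u v : S.Sec A} (σ : u ⟶ v) :
    wR c.top (Arrow.mk ((castSec e).map ((S.secRe f A).map σ)).cell) =
      wL f (Arrow.mk σ.cell) :=
  sec_castSec_cell e c _

end DisplayMap

namespace DisplayMap

open SplitDisplay

variable {C : Type u} [Bicategory.{w, v} C] [Bicategory.Strict C]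

theorem Cart.top_square {S : SplitDisplay C} {Λ Θ Θ' Ξ : C} {g : Θ ⟶ Ξ} {k : Λ ⟶ Θ} {g' : Θ' ⟶ Ξ}
    {k' : Λ ⟶ Θ'} {A : Disp S.D Ξ} {B : Disp S.D Θ} {B' : Disp S.D Θ'} {E : Disp S.D Λ}
    (c : Cart g B A) (d : Cart k E B) (c' : Cart g' B' A) (d' : Cart k' E B')
    (h : k ≫ g = k' ≫ g') : d.top ≫ c.top = d'.top ≫ c'.top := by
  rw [← comp_top c d (c.comp d), ← comp_top c' d' (c'.comp d')]
  exact top_congr h _ _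

variable [IsLocallyGroupoid C]

/-! ### Stability of identity types, `r`, `φ` and `{-}` -/

namespace AxiomaticId

variable {S : DisplayMap2Category C} (I : AxiomaticId S)

/-- No common base is assumed: equality of the whiskered `α` already gives equal sources, hence
equal composites to `Γ`, and then the comparison functor is injective on objects. -/
theorem tilde_unique {Γ X : C} {A : Disp S.D Γ} {x y : X ⟶ (I.Id A).obj}
    (h : wL x (Arrow.mk (I.α A).cell) = wL y (Arrow.mk (I.α A).cell)) : x = y := by
  have hb : y ≫ I.base A = x ≫ I.base A := by
    rw [← (I.s A).w, ← Category.assoc, ← Category.assoc]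
    exact congrArg (· ≫ A.p) (congrArg (·.left) h).symm
  have := (I.isArrowObject A (x ≫ I.base A)).1.injective (a₁ := ⟨x, rfl⟩) (a₂ := ⟨y, hb⟩)
    (SliceHom.arrow_mk_ext h)
  exact congrArg SliceHom.map this

/-- This is faithfulness of the comparison functor. Verticality is needed only for `x`, since the
base factors through `s`, where the two cells agree. -/
theorem arrow_unique {Γ X : C} {A : Disp S.D Γ} {x y : Arrow (X ⟶ (I.Id A).obj)}
    (hs : wR (I.s A).map x = wR (I.s A).map y) (ht : wR (I.t A).map x = wR (I.t A).map y)
    (hl : x.left = y.left) (hr : x.right = y.right) {h : X ⟶ Γ}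
    (hx : wR (I.base A) x = Arrow.mk (𝟙 h)) : x = y := by
  have hy : wR (I.base A) y = Arrow.mk (𝟙 h) := by
    rw [← hx, ← (I.s A).w, wR_comp, wR_comp, hs]
  obtain ⟨u, v, x⟩ := x
  obtain ⟨u', v', y⟩ := y
  obtain rfl : u = u' := hl
  obtain rfl : v = v' := hr
  have wu : u ≫ I.base A = h := congrArg (·.left) hx
  have wv : v ≫ I.base A = h := congrArg (·.right) hx
  obtain ⟨_, _, hx⟩ := (Arrow.mk_eq_mk_iff _ _).1 hx
  obtain ⟨_, _, hy⟩ := (Arrow.mk_eq_mk_iff _ _).1 hy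
  obtain ⟨_, _, hs⟩ := (Arrow.mk_eq_mk_iff _ _).1 hs
  obtain ⟨_, _, ht⟩ := (Arrow.mk_eq_mk_iff _ _).1 ht
  let U : SliceHom h (I.base A) := ⟨u, wu⟩
  let V : SliceHom h (I.base A) := ⟨v, wv⟩
  let σ : U ⟶ V := ⟨x, by simpa using hx⟩
  let τ : U ⟶ V := ⟨y, by simpa using hy⟩
  have := (I.isArrowObject A h).2.2
  have e : σ = τ := (SliceHom.arrowComparison (I.α A) h).map_injective (by
    refine Arrow.hom_ext _ _ (SliceHom.hom_ext _ _ ?_) (SliceHom.hom_ext _ _ ?_)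
    · exact (by simpa using hs : x ▷ (I.s A).map = y ▷ (I.s A).map)
    · exact (by simpa using ht : x ▷ (I.t A).map = y ▷ (I.t A).map))
  exact congrArg (fun σ : U ⟶ V => Arrow.mk σ.cell) e

theorem wR_s_φ {Γ : C} (A : Disp S.D Γ) :
    wR (I.s A).map (Arrow.mk (I.φ A)) = Arrow.mk (I.α A).cell := (I.φ_exists A).choose_spec.1

theorem wR_t_φ {Γ : C} (A : Disp S.D Γ) :
    wR (I.t A).map (Arrow.mk (I.φ A)) = Arrow.mk (𝟙 (I.t A).map) := (I.φ_exists A).choose_spec.2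

theorem wR_base_φ {Γ : C} (A : Disp S.D Γ) :
    wR (I.base A) (Arrow.mk (I.φ A)) = Arrow.mk (𝟙 (I.base A)) := by
  have h := congrArg (wR A.p) (I.wR_t_φ A)
  rwa [← wR_comp, wR_mk_id, (I.t A).w] at h

variable {Θ Ξ : C} {g : Θ ⟶ Ξ} {A' : Disp S.D Θ} {A : Disp S.D Ξ}

theorem cart (c : Cart g A' A) : Cart c.wk.top (I.Id A') (I.Id A) := by
  obtain rfl := c
  exact Cart.congr (show Cart (S.up₂ g A) _ _ from (I.Id_re g A).symm)
    (Cart.of_re_wk_top g A).symm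

theorem cart_top_src (c : Cart g A' A) :
    (I.cart c).top ≫ (I.s A).map = (I.s A').map ≫ c.top := by
  change _ ≫ (I.Id A).p ≫ (S.wk A).p = ((I.Id A').p ≫ (S.wk A').p) ≫ _
  rw [← Category.assoc, (I.cart c).top_p, Category.assoc, c.wk_top_p, Category.assoc]

theorem cart_top_tgt (c : Cart g A' A) :
    (I.cart c).top ≫ (I.t A).map = (I.t A').map ≫ c.top := by
  change _ ≫ (I.Id A).p ≫ S.up A.p A = ((I.Id A').p ≫ S.up A'.p A') ≫ _
  rw [← Category.assoc, (I.cart c).top_p, Category.assoc, c.wk_top_up, Category.assoc]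

theorem cart_top_base (c : Cart g A' A) :
    (I.cart c).top ≫ I.base A = I.base A' ≫ g := by
  rw [← (I.s A).w, ← Category.assoc, cart_top_src, Category.assoc, c.top_p, ← Category.assoc,
    (I.s A').w]

theorem up₃_eq {Γ Ξ : C} {f : Ξ ⟶ Γ} {A : Disp S.D Γ} {A' : Disp S.D Ξ} (c : Cart f A' A) :
    I.up₃ f c = (I.cart c).top := by
  obtain rfl := c
  exact Cart.top_congr (Cart.of_re_wk_top f A).symm
    (show Cart (S.up₂ f A) (I.Id (S.re A f)) (I.Id A) from (I.Id_re f A).symm) _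

theorem cart_top_α (c : Cart g A' A) :
    wR c.top (Arrow.mk (I.α A').cell) = wL (I.cart c).top (Arrow.mk (I.α A).cell) := by
  obtain rfl := c
  refine (congrArg (fun f => wR f _) (Cart.of_re_top g A)).trans ((I.α_re g A).trans ?_)
  exact congrArg (fun f => wL f (Arrow.mk (I.α A).cell)) (I.up₃_eq (Cart.of_re g A))

/-- Both composites turn `α` into the identity 2-cell on `c.top`. -/
theorem cart_top_r (c : Cart g A' A) :
    (I.r A').map ≫ (I.cart c).top = c.top ≫ (I.r A).map := by
  refine I.tilde_unique ?_
  have h := I.r_cell A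
  have h' := I.r_cell A'
  change wL _ (Arrow.mk _) = _ at h h'
  rw [wL_comp, ← cart_top_α, wL_wR, h', wL_comp, h, wR_mk_id, wL_mk_id, Category.id_comp,
    Category.comp_id]

/-- A 2-cell into the arrow object is known by its `s` and `t` components. Here these are the
re-indexed `α` and an identity on either side; the endpoints match by stability of `t` and `r`. -/
theorem cart_top_φ (c : Cart g A' A) :
    wR (I.cart c).top (Arrow.mk (I.φ A')) = wL (I.cart c).top (Arrow.mk (I.φ A)) := by
  refine I.arrow_unique (h := (I.cart c).top ≫ I.base A) ?_ ?_ ?_ ?_ ?_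
  · rw [← wR_comp, cart_top_src, wR_comp, wR_s_φ, ← wL_wR, wR_s_φ, cart_top_α]
  · rw [← wR_comp, cart_top_tgt, wR_comp, wR_t_φ, ← wL_wR, wR_t_φ, wR_mk_id, wL_mk_id,
      cart_top_tgt]
  · exact (Category.id_comp _).trans (Category.comp_id _).symm
  · change ((I.t A').map ≫ (I.r A').map) ≫ (I.cart c).top =
      (I.cart c).top ≫ (I.t A).map ≫ (I.r A).map
    rw [Category.assoc, cart_top_r, ← Category.assoc, ← cart_top_tgt, Category.assoc]
  · rw [← wR_comp, cart_top_base, wR_comp, wR_base_φ, wR_mk_id]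

section Curly

variable (c : Cart g A' A) {a' b' : S.Sec A'} {a b : S.Sec A}

/-- The re-indexing of `Id_A[a;b]`. -/
theorem cart_pair (ha : a'.map ≫ c.top = g ≫ a.map) (hb : b'.map ≫ c.top = g ≫ b.map) :
    Cart g (S.re (I.Id A') (pair a' b')) (S.re (I.Id A) (pair a b)) :=
  Cart.of_comp (Cart.of_re _ _) (Cart.comp (I.cart c) (Cart.of_re (pair a' b') _))
    (c.pair_wk_top ha hb).symm

theorem curly_up (σ : a ⟶ b) :
    (I.curly σ).map ≫ S.up (pair a b) (I.Id A) = (I.tilde σ).map := secOf_up _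

theorem wL_tilde {X : C} {h : X ⟶ Ξ} {x y : SliceHom h A.p} (σ : x ⟶ y) :
    wL (I.tilde σ).map (Arrow.mk (I.α A).cell) = Arrow.mk σ.cell := I.tilde_cell σ

theorem tilde_cart (σ' : a' ⟶ b') (σ : a ⟶ b)
    (h : wR c.top (Arrow.mk σ'.cell) = wL g (Arrow.mk σ.cell)) :
    (I.tilde σ').map ≫ (I.cart c).top = g ≫ (I.tilde σ).map := by
  refine I.tilde_unique ?_
  rw [wL_comp, ← cart_top_α, wL_wR, wL_tilde, wL_comp, wL_tilde, h]

theorem curly_cart (σ' : a' ⟶ b') (σ : a ⟶ b)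
    (h : wR c.top (Arrow.mk σ'.cell) = wL g (Arrow.mk σ.cell))
    (d : Cart g (S.re (I.Id A') (pair a' b')) (S.re (I.Id A) (pair a b))) :
    (I.curly σ').map ≫ d.top = g ≫ (I.curly σ).map := by
  have hp : pair a' b' ≫ c.wk.top = g ≫ pair a b :=
    c.pair_wk_top (congrArg (·.left) h) (congrArg (·.right) h)
  refine SplitDisplay.hom_ext ?_ ?_
  · have := Cart.top_square (Cart.of_re (pair a b) (I.Id A)) d (I.cart c) (Cart.of_re _ _) hp.symm
    rw [Cart.of_re_top, Cart.of_re_top] at this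
    rw [Category.assoc, this, ← Category.assoc, curly_up, Category.assoc, curly_up,
      I.tilde_cart c σ' σ h]
  · rw [Category.assoc, d.top_p, ← Category.assoc, (I.curly σ').w, Category.assoc, (I.curly σ).w,
      Category.id_comp, Category.comp_id]

/-- Both 1-cells classify the identity 2-cell on `a`. -/
theorem tilde_id (a : S.Sec A) : (I.tilde (𝟙 a)).map = a.map ≫ (I.r A).map := by
  refine I.tilde_unique ?_
  have h := I.r_cell A
  change wL _ (Arrow.mk _) = _ at h
  rw [wL_tilde, wL_comp, h, wL_mk_id, Category.comp_id]
  rfl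

end Curly

end AxiomaticId

/-! ### Stability of `Π`, `λ`, `app` and `λ{app -}` -/

namespace AxiomaticPi

variable {S : DisplayMap2Category C} (P : AxiomaticPi S)
variable {Θ Ξ : C} {g : Θ ⟶ Ξ} {A' : Disp S.D Θ} {A : Disp S.D Ξ} {B' : Disp S.D A'.obj}
  {B : Disp S.D A.obj}

theorem cart (cA : Cart g A' A) (cB : Cart cA.top B' B) : Cart g (P.Pi A' B') (P.Pi A B) := by
  obtain rfl := cA
  obtain rfl : B' = S.re B (S.up g A) := Cart.congr cB (Cart.of_re_top g A)
  exact (P.Pi_re g A B).symm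

theorem eqToHom_up_one (A : Disp S.D Ξ) :
    eqToHom (congrArg Disp.obj (S.re_id A).symm) ≫ S.up (𝟙 Ξ) A = 𝟙 A.obj := by
  simp [S.up_id]

theorem bump_up_one (g : Θ ⟶ Ξ) (A : Disp S.D Ξ) :
    bump A g (Category.comp_id g) = S.up g A ≫ eqToHom (congrArg Disp.obj (S.re_id A).symm) := by
  refine SplitDisplay.hom_ext ?_ ?_
  · rw [bump_up, Category.assoc, eqToHom_up_one, Category.comp_id]
  · rw [bump_p, Category.assoc, eqToHom_p (S.re_id A).symm, up_p]

/-- Re-indexing a section along `g` is precomposition with `g` followed by `1;(-)`, and `app`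
commutes with the first by `app_precomp` and with the second by `app_re`. -/
theorem appSec_cart (cA : Cart g A' A) (cB : Cart cA.top B' B) (cP : Cart g (P.Pi A' B') (P.Pi A B))
    {x' y' : S.Sec (P.Pi A' B')} {x y : S.Sec (P.Pi A B)} (σ' : x' ⟶ y') (σ : x ⟶ y)
    (h : wR cP.top (Arrow.mk σ'.cell) = wL g (Arrow.mk σ.cell)) :
    wR cB.top (Arrow.mk ((P.appSec A' B').map σ').cell) =
      wL cA.top (Arrow.mk ((P.appSec A B).map σ).cell) := by
  obtain rfl := cA
  obtain rfl : B' = S.re B (S.up g A) := Cart.congr cB (Cart.of_re_top g A)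
  rw [Cart.top_congr (Cart.of_re_top g A) cB (Cart.of_re _ _), Cart.of_re_top,
    show Cart.top _ = S.up g A from Cart.of_re_top g A]
  -- The hypothesis determines `σ'`: it is `σ[g]`, up to the identification of `Π[g]`.
  have e₁ := cP.sec_arrow_ext (h.trans (secRe_castSec_cell (P.Pi_re g A B) cP σ).symm)
  have e₂ := SliceHom.arrow_mk_cell (congrArg (P.app _ _ (𝟙 Θ)).mapArrow.obj e₁)
  have e₃ := SliceHom.arrow_mk_cell
    (congrArg (fun F => Arrow.mk (F.map ((SliceHom.precomp g (Category.comp_id g)).map σ)))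
      (P.app_re A B g))
  have e₄ := SliceHom.arrow_mk_cell
    (congrArg (fun F => Arrow.mk (F.map σ)) (P.app_precomp A B g (Category.comp_id g)))
  have e₅ := e₂.trans e₃.symm
  change Arrow.mk ((P.app _ _ (𝟙 Θ)).map σ').cell = wL (S.up (𝟙 Θ) (S.re A g)) (Arrow.mk
    ((S.sec (S.up g A) B).map ((P.app A B g).map _)).cell) at e₅
  change wL (bump A g _) (Arrow.mk ((P.app A B (𝟙 Ξ)).map σ).cell) = Arrow.mk
    ((P.app A B g).map _).cell at e₄
  change wR _ (wL (eqToHom _) (Arrow.mk ((P.app _ _ (𝟙 Θ)).map σ').cell)) =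
    wL _ (wL (eqToHom _) (Arrow.mk ((P.app A B (𝟙 Ξ)).map σ).cell))
  rw [e₅, ← wL_comp, ← wL_comp, eqToHom_up_one, wL_id, sec_cell, ← bump_up_one, e₄]

theorem lamSec_cart (cA : Cart g A' A) (cB : Cart cA.top B' B) (cP : Cart g (P.Pi A' B') (P.Pi A B))
    {x' : S.Sec B'} {x : S.Sec B} (h : x'.map ≫ cB.top = cA.top ≫ x.map) :
    ((P.lamSec A' B').obj x').map ≫ cP.top = g ≫ ((P.lamSec A B).obj x).map := by
  obtain rfl := cA
  obtain rfl : B' = S.re B (S.up g A) := Cart.congr cB (Cart.of_re_top g A)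
  rw [Cart.top_congr (Cart.of_re_top g A) cB (Cart.of_re _ _), Cart.of_re_top,
    show Cart.top _ = S.up g A from Cart.of_re_top g A] at h
  obtain rfl : x' = (S.secRe (S.up g A) B).obj x := sec_ext (h.trans (secRe_obj_up _ _ _).symm)
  have e₁ := congrArg (fun F => (F.obj
    ((SliceHom.precomp (S.up g A) (Category.comp_id _)).obj x)).map) (P.lam_re A B g)
  have e₂ := congrArg (fun F => (F.obj ((S.toOne A B).obj x)).map)
    (P.lam_precomp A B g (Category.comp_id g))
  have e₃ : (SliceHom.precomp (bump A g (Category.comp_id g)) (bump_up A g _)).obj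
      ((S.toOne A B).obj x) = (SliceHom.precomp (S.up g A) (Category.comp_id _)).obj x := by
    refine SliceHom.ext ?_
    change bump A g _ ≫ S.up (𝟙 Ξ) A ≫ x.map = S.up g A ≫ x.map
    rw [← Category.assoc, bump_up]
  -- Applied to an identity 2-cell, whose source then yields the required equation between 1-cells.
  have e₄ := sec_castSec_cell (P.Pi_re g A B) cP (𝟙 ((P.lam A B g).obj
    ((SliceHom.precomp (S.up g A) (Category.comp_id _)).obj x)))
  have e₅ := congrArg (·.left) e₄
  rw [Functor.comp_obj, Functor.comp_obj, e₃] at e₂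
  refine (congrArg (· ≫ cP.top) e₁.symm).trans (e₅.trans e₂.symm)

variable (I : AxiomaticId S)

/-- The display map `Π_A^{Id_B[app x;app y]}`. -/
noncomputable def happTy (x y : S.Sec (P.Pi A B)) : Disp S.D Ξ :=
  P.Pi A (S.re (I.Id B) (pair ((P.appSec A B).obj x) ((P.appSec A B).obj y)))

/-- The section `λ{app σ}` of `Π_A^{Id_B[app x;app y]}`. -/
noncomputable def lamHappOf {x y : S.Sec (P.Pi A B)} (σ : x ⟶ y) : S.Sec (P.happTy I x y) :=
  (P.lamSec _ _).obj (I.curly ((P.appSec A B).map σ))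

theorem lamHappOf_cart (cA : Cart g A' A) (cB : Cart cA.top B' B)
    {x' y' : S.Sec (P.Pi A' B')} {x y : S.Sec (P.Pi A B)} (σ' : x' ⟶ y') (σ : x ⟶ y)
    (h : wR (P.cart cA cB).top (Arrow.mk σ'.cell) = wL g (Arrow.mk σ.cell)) :
    ∃ c : Cart g (P.happTy I x' y') (P.happTy I x y),
      (P.lamHappOf I σ').map ≫ c.top = g ≫ (P.lamHappOf I σ).map := by
  have h' := P.appSec_cart cA cB _ σ' σ h
  have d := I.cart_pair cB (congrArg (·.left) h') (congrArg (·.right) h')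
  exact ⟨P.cart cA d, P.lamSec_cart cA d _ (I.curly_cart cB _ _ h' d)⟩

end AxiomaticPi

end DisplayMap

namespace DisplayMap

open SplitDisplay

variable {C : Type u} [Bicategory.{w, v} C] [Bicategory.Strict C]

/-! ### Stability of the chosen lifts -/

section Telescopes

variable {S : SplitDisplay C}

/-- The telescope formed by three display maps. -/
def SplitDisplay.Tele.three {Γ : C} (A : Disp S.D Γ) (W : Disp S.D A.obj) (J : Disp S.D W.obj) :
    S.Tele Γ :=
  .cons A (.cons W (.cons J (.nil J.obj)))

/-- Bridges the recursively defined re-indexing of a telescope and three successive `Cart` squares,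
so that the cleavage axiom applies to display maps over `Γ.A.A▼.Id_A`. The final `nil` only
contributes an identity 1-cell to the projection. -/
theorem SplitDisplay.Tele.three_cart {Γ Ξ : C} {f : Ξ ⟶ Γ} {A : Disp S.D Γ} {W : Disp S.D A.obj}
    {J : Disp S.D W.obj} {A' : Disp S.D Ξ} {W' : Disp S.D A'.obj} {J' : Disp S.D W'.obj}
    (cA : Cart f A' A) (cW : Cart cA.top W' W) (cJ : Cart cW.top J' J) :
    ∃ e : J'.obj = ((Tele.three A W J).re f).obj,
      cJ.top = eqToHom e ≫ (Tele.three A W J).up f ∧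
      J'.p ≫ W'.p ≫ A'.p = eqToHom e ≫ ((Tele.three A W J).re f).p := by
  obtain rfl := cA
  have hA : Cart.top _ = S.up f A := Cart.of_re_top f A
  obtain rfl : W' = S.re W (S.up f A) := Cart.congr cW hA
  have hW : cW.top = S.up (S.up f A) W :=
    (Cart.top_congr hA cW (Cart.of_re _ _)).trans (Cart.of_re_top _ _)
  obtain rfl : J' = S.re J (S.up (S.up f A) W) := Cart.congr cJ hW
  have hJ : cJ.top = S.up (S.up (S.up f A) W) J :=
    (Cart.top_congr hW cJ (Cart.of_re _ _)).trans (Cart.of_re_top _ _)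
  refine ⟨rfl, hJ.trans (Category.id_comp _).symm, ?_⟩
  simp [Tele.three, Tele.re, Tele.p, Tele.obj]

end Telescopes

theorem vertical_of_wR {X Y Γ : C} {p : Y ⟶ Γ} {h : X ⟶ Γ} {a b : X ⟶ Y} (σ : a ⟶ b)
    (ha : a ≫ p = h) (hb : b ≫ p = h) (e : wR p (Arrow.mk σ) = Arrow.mk (𝟙 h)) :
    σ ▷ p = eqToHom (ha.trans hb.symm) := by
  obtain ⟨_, _, e⟩ := (Arrow.mk_eq_mk_iff _ _).1 e
  simpa using e

section WhiskerInv

variable [IsLocallyGroupoid C]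

theorem wR_comp_inv {X Y Z : C} (f : Y ⟶ Z) {a b c d : X ⟶ Y} (σ : a ⟶ b) (x : c ⟶ d)
    (h : b = d) : wR f (Arrow.mk (σ ≫ eqToHom h ≫ inv x)) =
      Arrow.mk (σ ▷ f ≫ eqToHom (congrArg (· ≫ f) h) ≫ inv (x ▷ f)) := by
  subst h
  simp [wR]

theorem wL_comp_inv {X Y Z : C} (f : X ⟶ Y) {a b c d : Y ⟶ Z} (σ : a ⟶ b) (x : c ⟶ d)
    (h : b = d) : wL f (Arrow.mk (σ ≫ eqToHom h ≫ inv x)) =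
      Arrow.mk (f ◁ σ ≫ eqToHom (congrArg (f ≫ ·) h) ≫ inv (f ◁ x)) := by
  subst h
  simp [wL]

end WhiskerInv

variable [IsLocallyGroupoid C] {S : DisplayMap2Category C}

/-- Stability of the chosen lifts under re-indexing of telescopes, up to equality of objects. -/
theorem τ_cart {Γ Ξ : C} (f : Ξ ⟶ Γ) (T : S.Tele Γ) (hT : T ≠ Tele.nil Γ) {Z : C} {k : Z ⟶ T.obj}
    {q : Z ⟶ Ξ} (e : Z = (T.re f).obj) (hk : k = eqToHom e ≫ T.up f)
    (hq : q = eqToHom e ≫ (T.re f).p) {Q : Disp S.D T.obj} {Q' : Disp S.D Z} (c : Cart k Q' Q)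
    {Ω Ω' : C} (f' : Ω' ⟶ Ω) {g : Ω ⟶ Q.obj} {h : Ω ⟶ T.obj} {g' : Ω' ⟶ Q'.obj} {h' : Ω' ⟶ Z}
    (p : h ⟶ g ≫ Q.p) (p' : h' ⟶ g' ≫ Q'.p) (hg : g' ≫ c.top = f' ≫ g) (hh : h' ≫ k = f' ≫ h)
    (hp : wR T.p (Arrow.mk p) = Arrow.mk (𝟙 (h ≫ T.p)))
    (hp' : wR q (Arrow.mk p') = Arrow.mk (𝟙 (h' ≫ q)))
    (hpp' : wR k (Arrow.mk p') = wL f' (Arrow.mk p)) :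
    wR c.top (Arrow.mk (S.τ Q' g' p')) = wL f' (Arrow.mk (S.τ Q g p)) := by
  subst e
  obtain rfl : k = T.up f := hk.trans (Category.id_comp _)
  obtain rfl : q = (T.re f).p := hq.trans (Category.id_comp _)
  obtain rfl := c
  rw [show Cart.top _ = S.up (T.up f) Q from Cart.of_re_top _ _] at hg ⊢
  exact (S.cleavage_stable f T Q f' g h g' h' p p' hT hg hh hp hp' hpp').2

/-- Stability under re-indexing of the chosen lifts for a display map over the total object of
three display maps. -/
theorem τ_cart_three {Γ Ξ : C} {f : Ξ ⟶ Γ} {A : Disp S.D Γ} {W : Disp S.D A.obj}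
    {J : Disp S.D W.obj} {A' : Disp S.D Ξ} {W' : Disp S.D A'.obj} {J' : Disp S.D W'.obj}
    (cA : Cart f A' A) (cW : Cart cA.top W' W) (cJ : Cart cW.top J' J)
    {Q : Disp S.D J.obj} {Q' : Disp S.D J'.obj} (c : Cart cJ.top Q' Q)
    {Ω Ω' : C} (f' : Ω' ⟶ Ω) {g : Ω ⟶ Q.obj} {h : Ω ⟶ J.obj} {g' : Ω' ⟶ Q'.obj}
    {h' : Ω' ⟶ J'.obj} (p : h ⟶ g ≫ Q.p) (p' : h' ⟶ g' ≫ Q'.p)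
    (hg : g' ≫ c.top = f' ≫ g) (hh : h' ≫ cJ.top = f' ≫ h)
    (hp : wR (J.p ≫ W.p ≫ A.p) (Arrow.mk p) = Arrow.mk (𝟙 (h ≫ J.p ≫ W.p ≫ A.p)))
    (hp' : wR (J'.p ≫ W'.p ≫ A'.p) (Arrow.mk p') = Arrow.mk (𝟙 (h' ≫ J'.p ≫ W'.p ≫ A'.p)))
    (hpp' : wR cJ.top (Arrow.mk p') = wL f' (Arrow.mk p)) :
    wR c.top (Arrow.mk (S.τ Q' g' p')) = wL f' (Arrow.mk (S.τ Q g p)) := by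
  obtain ⟨e, hk, hq⟩ := Tele.three_cart cA cW cJ
  have hb : (Tele.three A W J).p = J.p ≫ W.p ≫ A.p := by
    simp [Tele.three, Tele.p, Tele.obj]
  exact τ_cart f (Tele.three A W J) (by simp [Tele.three]) e hk hq c f' p p' hg hh
    (by rw [hb]; exact hp) hp' hpp'

/-! ### The vertical 2-cell from `J_c` to a section restricting to `c` -/

namespace AxiomaticId

variable (I : AxiomaticId S)

section

variable {Γ : C} {A : Disp S.D Γ} {Q : Disp S.D (I.Id A).obj} (c : S.Sec (S.re Q (I.r A).map))
  (q : S.Sec Q) (h : c.map ≫ S.up (I.r A).map Q = (I.r A).map ≫ q.map)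

theorem J_source (I : AxiomaticId S) {Q : Disp S.D (I.Id A).obj}
    (c : S.Sec (S.re Q (I.r A).map)) :
    (I.t A).map ≫ (I.r A).map =
      ((I.t A).map ≫ c.map ≫ S.up (I.r A).map Q) ≫ Q.p := by
  rw [Category.assoc, Category.assoc, up_p, ← Category.assoc c.map, c.w, Category.id_comp]

/-- The 2-cell underlying `J_c ⟶ q`, for a section `q` whose re-indexing along `r_A` is `c`. -/
noncomputable def JCell : S.t Q ((I.t A).map ≫ c.map ≫ S.up (I.r A).map Q)
    (I.φ A ≫ eqToHom (I.J_source c)) ⟶ 𝟙 _ ≫ q.map :=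
  -- The lift ends at `r•ct`, which is `qrt` by `h`; from there the inverse of `q*φ` leads back to
  -- `q`.
  S.τ Q ((I.t A).map ≫ c.map ≫ S.up (I.r A).map Q) (I.φ A ≫ eqToHom (I.J_source c)) ≫
    eqToHom (by rw [h, Category.assoc]) ≫ inv (I.φ A ▷ q.map)

/-- The lift projects to `φ` by the choice of the cleavage, and `q*φ` projects to `φ` because `q` is
a section; the two cancel. -/
theorem wR_JCell : wR Q.p (Arrow.mk (I.JCell c q h)) = Arrow.mk (𝟙 (𝟙 (I.Id A).obj)) := by
  rw [JCell, wR_comp_inv]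
  have e₁ : Arrow.mk (S.τ Q ((I.t A).map ≫ c.map ≫ S.up (I.r A).map Q)
      (I.φ A ≫ eqToHom (I.J_source c)) ▷ Q.p) = Arrow.mk (I.φ A) := by
    rw [S.τ_p]
    exact arrow_mk_conj _ _ _
  have e₂ : Arrow.mk ((I.φ A ▷ q.map) ▷ Q.p) = Arrow.mk (I.φ A) := by
    change wR _ (wR _ (Arrow.mk (I.φ A))) = _
    rw [← wR_comp, q.w, wR_id]
  rw [arrow_mk_comp_inv_congr (h' := rfl) e₁ e₂]
  simp

/-- A section `q` of a display map over `Γ.A.A▼.Id_A` is homotopic to the elimination term of its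
re-indexing along `r_A`. -/
noncomputable def JHom : I.J Q c ⟶ q :=
  ⟨I.JCell c q h ≫ eqToHom (Category.id_comp _), vertical_of_wR _ (S.t_p Q _ _) q.w
    ((congrArg (wR Q.p) (arrow_mk_comp_eqToHom _ _)).trans (I.wR_JCell c q h))⟩

end

theorem JCell_cart {Γ Ξ : C} {f : Ξ ⟶ Γ} {A : Disp S.D Γ} {A' : Disp S.D Ξ} (cA : Cart f A' A)
    {Q : Disp S.D (I.Id A).obj} {Q' : Disp S.D (I.Id A').obj}
    (cQ : Cart (I.cart cA).top Q' Q) {c : S.Sec (S.re Q (I.r A).map)}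
    {c' : S.Sec (S.re Q' (I.r A').map)} {q : S.Sec Q} {q' : S.Sec Q'}
    (h : c.map ≫ S.up (I.r A).map Q = (I.r A).map ≫ q.map)
    (h' : c'.map ≫ S.up (I.r A').map Q' = (I.r A').map ≫ q'.map)
    (hq : q'.map ≫ cQ.top = (I.cart cA).top ≫ q.map) :
    wR cQ.top (Arrow.mk (I.JCell c' q' h')) =
      wL (I.cart cA).top (Arrow.mk (I.JCell c q h)) := by
  have hφ := I.cart_top_φ cA
  have e₁ := τ_cart_three cA cA.wk (I.cart cA) cQ
    (I.cart cA).top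
    (g := (I.t A).map ≫ c.map ≫ S.up (I.r A).map Q)
    (g' := (I.t A').map ≫ c'.map ≫ S.up (I.r A').map Q')
    (I.φ A ≫ eqToHom (I.J_source c)) (I.φ A' ≫ eqToHom (I.J_source c'))
    (by
      -- Through `h` and `h'` the lifted 1-cells become `qrt` and `q'r't'`, so stability of `q`, `r`
      -- and `t` suffices and none is needed for `c`.
      rw [h, h']
      simp only [Category.assoc]
      rw [hq, ← Category.assoc (I.r A').map, I.cart_top_r, ← Category.assoc (I.cart cA).top,
        I.cart_top_tgt]
      simp only [Category.assoc])
    ((Category.id_comp _).trans (Category.comp_id _).symm)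
    (by
      rw [arrow_mk_comp_eqToHom]
      exact (I.wR_base_φ A).trans (by rw [Category.id_comp]))
    (by
      rw [arrow_mk_comp_eqToHom]
      exact (I.wR_base_φ A').trans (by rw [Category.id_comp]))
    (by rw [arrow_mk_comp_eqToHom, arrow_mk_comp_eqToHom]; exact hφ)
  have e₂ : wR cQ.top (wR q'.map (Arrow.mk (I.φ A'))) =
      wL (I.cart cA).top (wR q.map (Arrow.mk (I.φ A))) := by
    rw [← wR_comp, hq, wR_comp, hφ, wL_wR]
  rw [JCell, JCell, wR_comp_inv, wL_comp_inv]
  exact arrow_mk_comp_inv_congr e₁ e₂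

theorem JHom_cart {Γ Ξ : C} {f : Ξ ⟶ Γ} {A : Disp S.D Γ} {A' : Disp S.D Ξ} (cA : Cart f A' A)
    {Q : Disp S.D (I.Id A).obj} {Q' : Disp S.D (I.Id A').obj}
    (cQ : Cart (I.cart cA).top Q' Q) {c : S.Sec (S.re Q (I.r A).map)}
    {c' : S.Sec (S.re Q' (I.r A').map)} {q : S.Sec Q} {q' : S.Sec Q'}
    (h : c.map ≫ S.up (I.r A).map Q = (I.r A).map ≫ q.map)
    (h' : c'.map ≫ S.up (I.r A').map Q' = (I.r A').map ≫ q'.map)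
    (hq : q'.map ≫ cQ.top = (I.cart cA).top ≫ q.map) :
    wR cQ.top (Arrow.mk (I.JHom c' q' h').cell) =
      wL (I.cart cA).top (Arrow.mk (I.JHom c q h).cell) :=
  ((congrArg (wR cQ.top) (arrow_mk_comp_eqToHom _ _)).trans (I.JCell_cart cA cQ h h' hq)).trans
    (congrArg (wL (I.cart cA).top) (arrow_mk_comp_eqToHom _ _).symm)

end AxiomaticId

/-- The existential over `Cart` makes the statement meaningful before and after the casts, so both
equalities can be substituted away. -/
theorem castSec_cart {Θ Ξ : C} {g : Θ ⟶ Ξ} {A₁ A₂ : Disp S.D Θ} {B₁ B₂ : Disp S.D Ξ}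
    (eA : A₁ = A₂) (eB : B₁ = B₂) {x : S.Sec A₁} {y : S.Sec B₁}
    (H : ∃ c : Cart g A₁ B₁, x.map ≫ c.top = g ≫ y.map) :
    ∃ c : Cart g A₂ B₂, ((castSec eA).obj x).map ≫ c.top = g ≫ ((castSec eB).obj y).map := by
  subst eA eB
  exact H

/-! ### The section `λ happ`: restriction along `r` and re-indexing -/

namespace AxiomaticPi

variable (P : AxiomaticPi S) (I : AxiomaticId S) {Γ : C} (A : Disp S.D Γ) (B : Disp S.D A.obj)

/-- `1;z`, as a section of `Π_{A[h]}^{B[h•]}`. -/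
noncomputable abbrev secPi {Ξ : C} (h : Ξ ⟶ Γ) :
    SliceHom h (P.Pi A B).p ⥤ S.Sec (P.Pi (S.re A h) (S.re B (S.up h A))) :=
  S.sec h (P.Pi A B) ⋙ castSec (P.Pi_re h A B)

theorem T_eq : P.happTy I ((P.secPi A B (I.base (P.Pi A B))).obj (I.s (P.Pi A B)))
    ((P.secPi A B (I.base (P.Pi A B))).obj (I.t (P.Pi A B))) = P.T A B I := by
  rw [T, ← P.appSec_sec (I.s (P.Pi A B)), ← P.appSec_sec (I.t (P.Pi A B))]
  rfl

theorem lamSec_castSec {A : Disp S.D Γ} {B : Disp S.D A.obj} {B' : Disp S.D A.obj} (e : B = B')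
    (e' : P.Pi A B = P.Pi A B') (x : S.Sec B) :
    (P.lamSec A B').obj ((castSec e).obj x) = (castSec e').obj ((P.lamSec A B).obj x) := by
  subst e
  rfl

theorem lamHapp_eq :
    P.lamHapp A B I = (castSec (P.T_eq I A B)).obj (P.lamHappOf I (P.αTilde A B I)) :=
  P.lamSec_castSec _ _ _

theorem αTilde_up (c : Cart (I.base (P.Pi A B))
      (P.Pi (S.re A (I.base (P.Pi A B))) (S.re B (S.up (I.base (P.Pi A B)) A))) (P.Pi A B)) :
    wR c.top (Arrow.mk (P.αTilde A B I).cell) = Arrow.mk (I.α (P.Pi A B)).cell :=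
  sec_castSec_cell _ _ _

/-- By `tilde_id`, the 1-cell classifying `1_ev` is `r` after `ev`. -/
theorem rEv_eq : P.rEv A B I = I.curly (𝟙 (P.ev A B)) := by
  rw [rEv, AxiomaticId.curly]
  congr 1
  exact SliceHom.ext (I.tilde_id _).symm

end AxiomaticPi

end DisplayMap

namespace DisplayMap

open SplitDisplay

variable {C : Type u} [Bicategory.{w, v} C] [Bicategory.Strict C]
variable [IsLocallyGroupoid C] {S : DisplayMap2Category C}

namespace AxiomaticPi

variable (P : AxiomaticPi S) (I : AxiomaticId S) {Γ : C} (A : Disp S.D Γ) (B : Disp S.D A.obj)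

/-- A 2-cell over `αTilde` along `g`, in terms of the 2-cells of `C / Γ` that they represent. -/
theorem over_αTilde {Θ : C} {g : Θ ⟶ P.idObj A B I} {A' : Disp S.D Θ} {B' : Disp S.D A'.obj}
    (cA : Cart g A' (S.re A (I.base (P.Pi A B))))
    (cB : Cart cA.top B' (S.re B (S.up (I.base (P.Pi A B)) A)))
    (cP : Cart (g ≫ I.base (P.Pi A B)) (P.Pi A' B') (P.Pi A B))
    {x' y' : S.Sec (P.Pi A' B')} (σ' : x' ⟶ y')
    (h : wR cP.top (Arrow.mk σ'.cell) = wL g (Arrow.mk (I.α (P.Pi A B)).cell)) :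
    wR (P.cart cA cB).top (Arrow.mk σ'.cell) = wL g (Arrow.mk (P.αTilde A B I).cell) := by
  have c : Cart (I.base (P.Pi A B))
      (P.Pi (S.re A (I.base (P.Pi A B))) (S.re B (S.up (I.base (P.Pi A B)) A))) (P.Pi A B) :=
    (P.Pi_re _ A B).symm
  -- Along the 1-cell over the base, `α̃` becomes `α`, which is the hypothesis; under the projection
  -- both sides are identities.
  refine c.arrow_ext ?_ ?_
  · rw [← wR_comp, ← Cart.comp_top c (P.cart cA cB) cP, h, ← wL_wR, P.αTilde_up]
  · rw [← wR_comp, Cart.top_p, wR_comp, SliceHom.wR_cell, wR_mk_id, ← wL_wR, SliceHom.wR_cell,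
      wL_mk_id, Category.id_comp, Category.comp_id]

/-- The restriction of `α̃` along `r` is the identity on the section `1;1`, and `app` takes this
section to `ev`. Hence `λ{app α̃}` restricts to `λ{1_ev}`, which is `λ(r[ev])`. -/
theorem lamHapp_r :
    ((castSec (P.T_r A B I)).obj ((P.lamSec _ _).obj (P.rEv A B I))).map ≫
      S.up (I.r (P.Pi A B)).map (P.T A B I) =
    (I.r (P.Pi A B)).map ≫ (P.lamHapp A B I).map := by
  have hr := (I.r (P.Pi A B)).w
  have cA : Cart (I.r (P.Pi A B)).map (S.re A (P.Pi A B).p) (S.re A (I.base (P.Pi A B))) :=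
    Cart.of_comp (Cart.of_re _ A) (Cart.of_re _ A) hr
  have hA : cA.top ≫ S.up (I.base (P.Pi A B)) A = S.up (P.Pi A B).p A := by
    rw [← Cart.of_re_top (I.base (P.Pi A B)) A, ← Cart.of_re_top (P.Pi A B).p A,
      ← Cart.comp_top (Cart.of_re _ A) cA (Cart.comp (Cart.of_re _ A) cA)]
    exact Cart.top_congr hr _ _
  have cB : Cart cA.top (S.re B (S.up (P.Pi A B).p A))
      (S.re B (S.up (I.base (P.Pi A B)) A)) :=
    Cart.of_comp (Cart.of_re _ B) (Cart.of_re _ B) hA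
  -- The generic section `1;1` of `Π[P_Π]`, the common restriction of `s̃` and `t̃` along `r`.
  let z : S.Sec _ := (P.secPi A B (P.Pi A B).p).obj ⟨𝟙 _, Category.id_comp _⟩
  have cP := Cart.congr (show Cart (P.Pi A B).p _ _ from (P.Pi_re (P.Pi A B).p A B).symm) hr.symm
  have hz : wR cP.top (Arrow.mk (SliceHom.Hom.cell (𝟙 z))) =
      wL (I.r (P.Pi A B)).map (Arrow.mk (I.α (P.Pi A B)).cell) := by
    refine Eq.trans ?_ (I.r_cell (P.Pi A B)).symm
    rw [Cart.top_congr hr cP (P.Pi_re (P.Pi A B).p A B).symm]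
    have := sec_castSec_cell (P.Pi_re (P.Pi A B).p A B) (P.Pi_re (P.Pi A B).p A B).symm
      (𝟙 (⟨𝟙 _, Category.id_comp _⟩ : SliceHom (P.Pi A B).p (P.Pi A B).p))
    rw [CategoryTheory.Functor.map_id] at this
    exact this
  have H := P.lamHappOf_cart I cA cB (𝟙 z) (P.αTilde A B I) (P.over_αTilde I A B cA cB cP _ hz)
  have hev : (P.appSec _ _).obj z = P.ev A B := (P.appSec_sec _).trans P.evAt_one
  have eT : P.happTy I z z = S.re (P.T A B I) (I.r (P.Pi A B)).map := by
    rw [← P.T_r, happTy, hev]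
  obtain ⟨c, hc⟩ := castSec_cart eT (P.T_eq I A B) H
  rw [P.lamHapp_eq, ← hc, Cart.top_congr rfl c (Cart.of_re _ _), Cart.of_re_top]
  congr 2
  -- `app z` equals `ev` only propositionally and occurs in the types; replacing it by a variable
  -- `y` allows the equality to be eliminated.
  have key : ∀ (y : S.Sec (S.re B (S.up (P.Pi A B).p A))) (τ : y ⟶ y) (e : y = P.ev A B)
      (_ : τ = 𝟙 y) (e₁ : P.Pi _ (S.re (I.Id _) (pair y y)) = S.re (P.T A B I) _),
      (castSec (P.T_r A B I)).obj ((P.lamSec _ _).obj (I.curly (𝟙 (P.ev A B)))) =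
        (castSec e₁).obj ((P.lamSec _ _).obj (I.curly τ)) := by
    rintro _ _ rfl rfl _
    rfl
  rw [P.rEv_eq]
  exact key _ _ hev (CategoryTheory.Functor.map_id _ _) eT

/-- The bases of the two identity types form a commutative square with `f•••` and `f`. Over it, both
`α̃` are representatives of the respective `α`, so stability of `α` becomes stability of `α̃`, and
`λ{app -}` preserves it. -/
theorem lamHapp_cart {Ξ : C} (f : Ξ ⟶ Γ)
    (cP : Cart f (P.Pi (S.re A f) (S.re B (S.up f A))) (P.Pi A B)) :
    ∃ c : Cart (I.cart cP).top (P.T (S.re A f) (S.re B (S.up f A)) I) (P.T A B I),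
      (P.lamHapp (S.re A f) (S.re B (S.up f A)) I).map ≫ c.top =
        (I.cart cP).top ≫ (P.lamHapp A B I).map := by
  set A' := S.re A f
  set B' := S.re B (S.up f A)
  have hb := I.cart_top_base cP
  have dA : Cart f A' A := Cart.of_re f A
  have dA_top : dA.top = S.up f A := Cart.of_re_top f A
  have dB : Cart dA.top B' B := Cart.congr (Cart.of_re _ B) dA_top.symm
  have bA := Cart.of_re (I.base (P.Pi A B)) A
  have bA' := Cart.of_re (I.base (P.Pi A' B')) A'
  have cA : Cart (I.cart cP).top (S.re A' (I.base (P.Pi A' B'))) (S.re A (I.base (P.Pi A B))) :=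
    Cart.of_comp bA (Cart.comp dA bA') hb
  have hA : cA.top ≫ S.up (I.base (P.Pi A B)) A = S.up (I.base (P.Pi A' B')) A' ≫ dA.top := by
    rw [← Cart.of_re_top (I.base (P.Pi A B)) A, ← Cart.of_re_top (I.base (P.Pi A' B')) A']
    exact Cart.top_square bA cA dA bA' hb
  have cB : Cart cA.top (S.re B' (S.up (I.base (P.Pi A' B')) A'))
      (S.re B (S.up (I.base (P.Pi A B)) A)) :=
    Cart.of_comp (Cart.of_re _ B) (Cart.comp dB (Cart.of_re _ B')) hA
  have bP' : Cart (I.base (P.Pi A' B')) (P.Pi (S.re A' (I.base (P.Pi A' B')))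
      (S.re B' (S.up (I.base (P.Pi A' B')) A'))) (P.Pi A' B') := (P.Pi_re _ A' B').symm
  have h : wR (Cart.congr (cP.comp bP') hb.symm).top (Arrow.mk (P.αTilde A' B' I).cell) =
      wL (I.cart cP).top (Arrow.mk (I.α (P.Pi A B)).cell) := by
    -- Over `Π` the 1-cell factors through the re-indexing to `Ξ`, where `α̃` turns into the `α` of
    -- the re-indexed `Π`.
    rw [Cart.top_congr hb _ (cP.comp bP'), Cart.comp_top cP bP', wR_comp, P.αTilde_up,
      I.cart_top_α]
  have H := P.lamHappOf_cart I cA cB (P.αTilde A' B' I) (P.αTilde A B I)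
    (P.over_αTilde I A B cA cB _ _ h)
  rw [P.lamHapp_eq, P.lamHapp_eq]
  exact castSec_cart (P.T_eq I A' B') (P.T_eq I A B) H

end AxiomaticPi

end DisplayMap

open DisplayMap

theorem mainTheorem5 {C : Type u} [Bicategory.{w, v} C] [Bicategory.Strict C] [IsLocallyGroupoid C]
    (S : DisplayMap.DisplayMap2Category C) (I : DisplayMap.AxiomaticId S)
    (P : DisplayMap.AxiomaticPi S) :
    ∃ θ : ∀ {Γ : C} (A : DisplayMap.Disp S.D Γ) (B : DisplayMap.Disp S.D A.obj),
        P.happly A B I ⟶ P.lamHapp A B I,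
      ∀ {Γ Ξ : C} (f : Ξ ⟶ Γ) (A : DisplayMap.Disp S.D Γ) (B : DisplayMap.Disp S.D A.obj),
        ∃ e : S.re (P.T A B I) (P.reIdx A B I f) = P.T (S.re A f) (S.re B (S.up f A)) I,
          Arrow.mk ((DisplayMap.SplitDisplay.castSec e).map
              ((S.secRe (P.reIdx A B I f) (P.T A B I)).map (θ A B))) =
            Arrow.mk (θ (S.re A f) (S.re B (S.up f A))) := by
  -- The 2-cell `J_c ⇒ q` for `q = λ happ`; the source is `happly` because `c` is the section used
  -- to define it.
  refine ⟨fun A B => I.JHom _ _ (P.lamHapp_r I A B), fun f A B => ?_⟩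
  have cP : Cart f (P.Pi (S.re A f) (S.re B (S.up f A))) (P.Pi A B) := (P.Pi_re f A B).symm
  obtain ⟨c, hc⟩ := P.lamHapp_cart I A B f cP
  have hk : P.reIdx A B I f = (I.cart cP).top := I.up₃_eq cP
  have d : Cart (P.reIdx A B I f) (P.T (S.re A f) (S.re B (S.up f A)) I) (P.T A B I) :=
    Cart.congr c hk.symm
  -- Both sides are vertical, so they are compared after the 1-cell over `f•••`, where the
  -- re-indexed `θ` becomes `θ` whiskered on the left.
  refine ⟨Eq.symm d, d.sec_arrow_ext ?_⟩
  refine (secRe_castSec_cell (Eq.symm d) d _).trans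
    (Eq.trans ?_ (congrArg (wR · _) (Cart.top_congr hk d c).symm))
  rw [hk]
  exact (I.JHom_cart cP c _ _ hc).symm
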